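/- Let $K$ be a number field, $B$ a smooth projective geometrically integral curve over $K$, and $E$ a non-isotrivial elliptic curve over the function field $K(B)$ (the generic fibre of an elliptic surface $\mathcal E\to B$ over $K$), given by a Weierstrass equation with discriminant $\Delta$. For a place $v$ of $K$ let $B_v^{\rm an}$ be the Berkovich analytification of $B$ over $\mathbb C_v$, the completion of an algebraic closure of $K_v$. For an elliptic curve over a field with an absolute value, $\hat\lambda$ denotes the local Néron height, normalized so that $\hat\lambda(P)-\tfrac12\log|x(P)|$ has a limit as $P\to O$ and $\hat\lambda(2P)=4\hat\lambda(P)-\log|2y+a_1x+a_3|+\tfrac14\log|\Delta|$ for $2P\ne O$; explicitly, $\hat\lambda(P)=\tfrac12\lim_n 4^{-n}\log\max(|A_n|,|B_n|)-\tfrac1{12}\log|\Delta|$, where $(A_n:B_n)=x(2^nP)$ is obtained from $(x(P),1)$ by iterating the homogeneous duplication polynomials. For a point $P\neq O$ of $E(K(B))$ set $\overline D_P=(D_P,\{\lambda_{P,v}\}_v)$, where $$D_P=\sum_{\gamma}\hat\lambda_{E,\mathrm{ord}_\gamma}(P)\,[\gamma],$$ the sum being over $\gamma\in B(\overline K)$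 (equivalently, over the closed points of $B$) with $|f|_\gamma=\exp(-\mathrm{ord}_\gamma f)$, and where, for each place $v$ of $K$, $\lambda_{P,v}$ is the extension by continuity to $B_v^{\rm an}\setminus\operatorname{supp}D_P$ of the function $t\mapsto\hat\lambda_{E_t,v}(P_t)$, defined where the fibre $E_t$ is smooth and $P_t\ne O_t$. Set $\overline D_O=(0,0)$. Real linear combinations of pairs $(D,\{g_v\}_v)$ are taken in both entries. Two such pairs are isomorphic, $\overline D_1\simeq\overline D_2$, if there are nonzero $\phi_1,\dots,\phi_r\in K(B)$ and $c_1,\dots,c_r\in\mathbb R$ such that $$\overline D_1-\overline D_2=\sum_{i=1}^r c_i\,\bigl((\phi_i),\{-\log|\phi_i|_v\}_v\bigr),$$ the functions being compared, at every place $v$, on the complement of the supports of all the divisors involved. Then: 1. If $P,Q\in E(K(B))$ differ by a torsion point, then $\overline D_P\simeq\overline D_Q$; that is, up to isomorphism $\overline D_P$ depends only on the class of $P$ modulo torsion. 2. For all $m$, all points $P_1,\dots,P_m\in E(K(B))$ that are linearly independent over $\mathbb Z$, and all integers $a_1,\dots,a_m$, $$\overline D_{a_1P_1+\cdots+a_mP_m}\simeq\sum_{i=1}^m\Bigl(a_i^2-a_i\sum_{j\ne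 i}a_j\Bigr)\overline D_{P_i}+\sum_{1\le i<j\le m}a_ia_j\,\overline D_{P_i+P_j}.$$ -/

import Mathlib

open CategoryTheory CategoryTheory.Limits AlgebraicGeometry Filter Topology

noncomputable section

/-! ## The places of a number field -/

/-- The complete algebraically closed field attached to a place of `ℚ`:
`ℂ` at the archimedean place (`none`), and `ℂ_[p]` at the prime `p` (`some p`). -/
def CompleteAlgClosed : Option Nat.Primes → Type
  | none => ℂ
  | some p => haveI : Fact (p : ℕ).Prime := ⟨p.2⟩; ℂ_[(p : ℕ)]

instance CompleteAlgClosed.instNormedField :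
    (q : Option Nat.Primes) → NormedField (CompleteAlgClosed q)
  | none => inferInstanceAs (NormedField ℂ)
  | some p => haveI : Fact (p : ℕ).Prime := ⟨p.2⟩; inferInstanceAs (NormedField ℂ_[(p : ℕ)])

/-- A place `v` of the number field `K` together with the embedding of `K` in
`ℂ_v` (the completion of an algebraic closure of `K_v`, which is `ℂ` or `ℂ_[p]`).
The absolute value is `|x|_v = ‖emb x‖`; it extends the standard absolute value of `ℚ`, and every
place of `K` arises in this way, from embeddings that differ by an isometry of `ℂ_v`. -/
structure NumberFieldPlace (K : Type) [Field K] where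
  /-- the place of `ℚ` below -/
  below : Option Nat.Primes
  /-- the embedding of `K` in `ℂ_v` -/
  emb : K →+* CompleteAlgClosed below

/-- The field `ℂ_v`. -/
abbrev NumberFieldPlace.Cv {K : Type} [Field K] (v : NumberFieldPlace K) : Type :=
  CompleteAlgClosed v.below

/-! ## Berkovich analytification -/

/-- The ring homomorphism `L → κ(x)` for a point `x` of an `L`-scheme. -/
def constToResidueField {L : Type} [CommRing L] {X : Scheme.{0}} (p : X ⟶ Spec (.of L)) (x : X) :
    L →+* X.residueField x :=
  (Spec.preimage (X.fromSpecResidueField x ≫ p)).hom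

/-- The points of the Berkovich analytification of a scheme `X` over a complete field `L`: a point
of `X` with an absolute value on its residue field that extends the one of `L`. -/
structure BerkovichSpace {L : Type} [NormedField L] {X : Scheme.{0}} (p : X ⟶ Spec (.of L)) where
  /-- the underlying scheme point -/
  pt : X
  /-- the absolute value on the residue field -/
  abv : AbsoluteValue (X.residueField pt) ℝ
  abv_const : ∀ c : L, abv (constToResidueField p pt c) = ‖c‖

/-- The Berkovich topology: the coarsest one for which, for every open `U` and every `f ∈ 𝒪(U)`,
the set of points over `U` is open and `x ↦ |f(x)|` is continuous on it. -/
instance BerkovichSpace.instTopologicalSpace {L : Type} [NormedField L] {X : Scheme.{0}}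
    (p : X ⟶ Spec (.of L)) : TopologicalSpace (BerkovichSpace p) :=
  TopologicalSpace.generateFrom
    {S | ∃ (U : X.Opens) (f : Γ(X, U)) (V : Set ℝ), IsOpen V ∧
      S = {x | ∃ h : x.pt ∈ U, x.abv ((X.evaluation U x.pt h).hom f) ∈ V}}

/-! ## Curves over a number field -/

/-- A smooth projective (equivalently, smooth and proper) geometrically integral curve over `K`. -/
structure SmoothProjCurve (K : Type) [Field K] where
  /-- the underlying scheme -/
  X : Scheme.{0}
  /-- the structure morphism -/
  str : X ⟶ Spec (.of K)
  proper : IsProper str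
  smooth : SmoothOfRelativeDimension 1 str
  geomIntegral : GeometricallyIntegral str

namespace SmoothProjCurve

variable {K : Type} [Field K] (B : SmoothProjCurve K)

instance : IsProper B.str := B.proper
instance : GeometricallyIntegral B.str := B.geomIntegral
instance : IsIntegral B.X := GeometricallyIntegral.isIntegral_of_subsingleton B.str
instance : IsLocallyNoetherian B.X := LocallyOfFiniteType.isLocallyNoetherian B.str

/-- The function field `K(B)`. -/
abbrev FF : Type := B.X.functionField

/-- The constants `K → K(B)`. -/
def constFF : K →+* B.FF :=
  (Spec.preimage (B.X.fromSpecStalk (genericPoint B.X) ≫ B.str)).hom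

/-- The closed points of `B`, as its points of codimension one. They are the `Gal(K̄/K)`-orbits in
`B(K̄)`, so a real-valued function on `B.ClosedPt` is a Galois invariant one on `B(K̄)`. -/
abbrev ClosedPt : Type := {z : B.X // Order.coheight z = 1}

/-- The absolute value `|φ|_γ = exp (-ord_γ φ)` on `K(B)`, for a closed point `γ`. -/
def absOrd (z : B.ClosedPt) (φ : B.FF) : ℝ :=
  open scoped Classical in
  if φ = 0 then 0 else Real.exp (-(B.X.ord φ z.1 : ℝ))

variable (v : NumberFieldPlace K)

/-- The base change `B ×_K ℂ_v`. -/
abbrev baseChange : Scheme.{0} := pullback B.str (Spec.map (CommRingCat.ofHom v.emb))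

/-- The Berkovich analytification `B_v^an` of `B` over `ℂ_v`. -/
abbrev Ban : Type :=
  BerkovichSpace (pullback.snd B.str (Spec.map (CommRingCat.ofHom v.emb)))

variable {B v}

/-- The point of the scheme `B` below `x ∈ B_v^an`: a closed point if `x` is a point of `B(K̄)`,
and the generic point of `B` otherwise. -/
def center (x : B.Ban v) : B.X :=
  pullback.fst B.str (Spec.map (CommRingCat.ofHom v.emb)) x.pt

/-- The residue field at `x ∈ B_v^an` (it is `ℂ_v` if `x` is a classical point). -/
abbrev Kappa (x : B.Ban v) : Type := (B.baseChange v).residueField x.pt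

/-- `φ ∈ K(B)` has no pole at `x`. -/
def Regular (x : B.Ban v) (φ : B.FF) : Prop :=
  ∃ s : B.X.presheaf.stalk (center x), algebraMap _ B.FF s = φ

/-- The value `φ(x)` of a rational function `φ ∈ K(B)` that is regular at `x` (`0` at a pole). -/
def value (x : B.Ban v) (φ : B.FF) : Kappa x :=
  open scoped Classical in
  if h : Regular x φ then
    ((pullback.fst B.str (Spec.map (CommRingCat.ofHom v.emb))).residueFieldMap x.pt).hom
      ((B.X.residue (center x)).hom h.choose)
  else 0

end SmoothProjCurve

/-! ## Local Néron heights -/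

section LocalHeight

variable {L : Type} [CommRing L]

/-- Duplication on the `x`-line of a Weierstrass curve, in homogeneous coordinates:
`x(2P) = (x⁴ - b₄x² - 2b₆x - b₈) / (4x³ + b₂x² + 2b₄x + b₆)`. -/
def dupX (W : WeierstrassCurve L) (u : L × L) : L × L :=
  (u.1 ^ 4 - W.b₄ * u.1 ^ 2 * u.2 ^ 2 - 2 * W.b₆ * u.1 * u.2 ^ 3 - W.b₈ * u.2 ^ 4,
   4 * u.1 ^ 3 * u.2 + W.b₂ * u.1 ^ 2 * u.2 ^ 2 + 2 * W.b₄ * u.1 * u.2 ^ 3 + W.b₆ * u.2 ^ 4)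

/-- Tate's limit formula for the local Néron height `λ̂(P)` of an affine point `P` with
`x`-coordinate `ξ` on a Weierstrass curve over a field with absolute value `abv`:
`λ̂(P) = 1/2 lim 4⁻ⁿ log max(|Aₙ|, |Bₙ|) - 1/12 log |Δ|`, where `(Aₙ : Bₙ)` is `x(2ⁿP)`.
This is the normalization with `λ̂(P) - 1/2 log |x(P)|` convergent for `P → O` and
`λ̂(2P) = 4 λ̂(P) - log |2y + a₁x + a₃| + 1/4 log |Δ|`; it does not depend on the Weierstrass
equation. -/
def localHeight (abv : L → ℝ) (W : WeierstrassCurve L) (ξ : L) : ℝ :=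
  1 / 2 * limUnder atTop (fun n : ℕ =>
      Real.log (max (abv ((dupX W)^[n] (ξ, 1)).1) (abv ((dupX W)^[n] (ξ, 1)).2)) / 4 ^ n)
    - 1 / 12 * Real.log (abv W.Δ)

end LocalHeight

/-! ## Elliptic curves over the function field and their specializations -/

namespace SmoothProjCurve

variable {K : Type} [Field K] {B : SmoothProjCurve K}

/-- All smooth fibres are geometrically isomorphic: the `j`-invariant is constant. -/
def IsIsotrivial (E : WeierstrassCurve B.FF) [E.IsElliptic] : Prop :=
  ∃ c : K, B.constFF c = E.j

/-- The group `E(K(B))`, i.e. the sections of the elliptic surface that are defined over `K`. -/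
abbrev MW (E : WeierstrassCurve B.FF) : Type := E.toAffine.Point

instance (E : WeierstrassCurve B.FF) : AddCommGroup (MW E) :=
  open scoped Classical in inferInstanceAs (AddCommGroup E.toAffine.Point)

variable {v : NumberFieldPlace K}

/-- The fibre `E_x` over `x ∈ B_v^an`, as a Weierstrass curve over the residue field at `x`. -/
def fibre (E : WeierstrassCurve B.FF) (x : B.Ban v) : WeierstrassCurve (Kappa x) :=
  ⟨value x E.a₁, value x E.a₂, value x E.a₃, value x E.a₄, value x E.a₆⟩

/-- The fibre `E_x` is a smooth Weierstrass curve, and the point of `E` with `x`-coordinate `ξ`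
specializes to an affine point of it (so not to the zero `O_x`). -/
def GoodAt (E : WeierstrassCurve B.FF) (ξ : B.FF) (x : B.Ban v) : Prop :=
  Regular x E.a₁ ∧ Regular x E.a₂ ∧ Regular x E.a₃ ∧ Regular x E.a₄ ∧ Regular x E.a₆ ∧
    (fibre E x).Δ ≠ 0 ∧ Regular x ξ

/-- The local height `λ̂_{E_x}(P_x)` of the specialization at `x`; here `ξ = x(P)`. -/
def fibreHeight (E : WeierstrassCurve B.FF) (ξ : B.FF) (x : B.Ban v) : ℝ :=
  localHeight x.abv (fibre E x) (value x ξ)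

/-- The function `λ_{P,v}` on `B_v^an`: it is `x ↦ λ̂_{E_x}(P_x)` where the fibre is smooth and
`P_x ≠ O_x`, extended by continuity to the remaining finitely many points. It carries no
information at the points of `supp D_P`, where it has logarithmic singularities. -/
def green (E : WeierstrassCurve B.FF) (ξ : B.FF) (x : B.Ban v) : ℝ :=
  open scoped Classical in
  if GoodAt E ξ x then fibreHeight E ξ x
  else limUnder (𝓝[{y | GoodAt E ξ y}] x) (fibreHeight E ξ)

/-! ## Metrized divisors -/

/-- The data `(D, {g_v}_v)` of a (Galois invariant) `ℝ`-divisor `D` on `B`, given by its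
coefficients, and a function `g_v` on `B_v^an` for each place `v` of `K`; the values of `g_v` on
`supp D` are irrelevant. Sums and real multiples are taken in both entries. -/
abbrev MetrizedDivisor (B : SmoothProjCurve K) : Type :=
  (B.ClosedPt → ℝ) × (∀ v : NumberFieldPlace K, B.Ban v → ℝ)

/-- `x ∈ B_v^an` does not lie in the support of the divisor `D`. -/
def OffSupport (D : B.ClosedPt → ℝ) (x : B.Ban v) : Prop :=
  ∀ z : B.ClosedPt, z.1 = center x → D z = 0

/-- The principal metrized divisor `((φ), {-log |φ|_v}_v)` of a rational function. -/
def principal (φ : B.FF) : MetrizedDivisor B :=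
  (fun z => (B.X.ord φ z.1 : ℝ), fun _ x => -Real.log (x.abv (value x φ)))

/-- `M ≅ N`: the difference is `∑ aᵢ ((φᵢ), {-log |φᵢ|_v}_v)` with `φᵢ ∈ K(B)` nonzero and
`aᵢ ∈ ℝ`. The divisors agree, and at every place the functions agree at every point outside the
supports of `M`, of `N` and of the `φᵢ`, i.e. wherever all of them are defined. (The functions
`g_v` being continuous outside the supports, they then agree as continuous functions.) -/
def Isomorphic (M N : MetrizedDivisor B) : Prop :=
  ∃ (r : ℕ) (φ : Fin r → B.FF) (a : Fin r → ℝ), (∀ i, φ i ≠ 0) ∧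
    M.1 - N.1 = ∑ i, a i • (principal (φ i)).1 ∧
    ∀ (v : NumberFieldPlace K) (x : B.Ban v),
      OffSupport M.1 x → OffSupport N.1 x → (∀ i, OffSupport (principal (φ i)).1 x) →
      M.2 v x - N.2 v x = ∑ i, a i * (principal (φ i)).2 v x

/-- The metrized divisor `D̄_P = (D_P, {λ_{P,v}}_v)` with `D_P = ∑_γ λ̂_{E, ord_γ}(P) [γ]`
for `P ≠ O`, and `D̄_O = (0, 0)`. -/
def Dbar (E : WeierstrassCurve B.FF) : MW E → MetrizedDivisor B
  | .zero => 0
  | .some ξ _ _ => (fun z => localHeight (B.absOrd z) E ξ, fun _ x => green E ξ x)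

end SmoothProjCurve

end

/-! ## The duplication and the addition-and-subtraction relation on `x`-coordinates -/

/-! Modulo the real span of the principal metrized divisors, `P ↦ D̄_P` satisfies the parallelogram
law. Both claims are then formal facts about quadratic maps from an abelian group to a real vector
space: torsion lies in the kernel of the polar form, and polarization expands the value at an
integer combination (`parallelogram_eq_of_isOfFinAddOrder`, `parallelogram_sum_zsmul`).

The parallelogram law comes from one identity over a field with an arbitrary absolute value: λ̂(P+Q)
+ λ̂(P−Q) = 2λ̂(P) + 2λ̂(Q) − log|x(P)−x(Q)| + (1/6) log|Δ| (`localHeight_quasiParallelogram`). It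
applies to ord_γ on K(B) and to the fibre over a point of B_v^an, with the same rational functions
x(P)−x(Q) and Δ, so the defect is principal. The cases P = ±Q use the duplication formula and its
analogue at points of order two.

The local identity is an exact parallelogram law for Tate's limit T on L²
(`tateLimit_parallelogram`). Polynomial estimates bound its defect from above. Replacing (P, Q) by
(P+Q, P−Q) multiplies the defect by −2, so a one-sided bound forces it to vanish.

Smoothness of B makes the local rings at closed points discrete valuation rings. Hence |·|_γ is an
absolute value, and a function is a unit wherever it has neither zero nor pole, so polynomial
identities over K(B) specialize to the fibres outside finitely many closed points. -/

/-- The coordinates of `u₃` and `u₄` are, up to a common scaling, the `x`-coordinates of the sum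
and of the difference of points with `x`-coordinates `u₁` and `u₂`. -/
structure AddSubRel {R : Type} [CommRing R] (W : WeierstrassCurve R) (u₁ u₂ u₃ u₄ : R × R) :
    Prop where
  fst_mul_fst : u₃.1 * u₄.1 = (u₁.1 * u₂.1) ^ 2 - W.b₄ * (u₁.1 * u₂.1) * (u₁.2 * u₂.2) -
    W.b₆ * (u₁.1 * u₂.2 + u₂.1 * u₁.2) * (u₁.2 * u₂.2) - W.b₈ * (u₁.2 * u₂.2) ^ 2
  cross : u₃.1 * u₄.2 + u₄.1 * u₃.2 = 2 * (u₁.1 * u₂.2 + u₂.1 * u₁.2) * (u₁.1 * u₂.1) +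
    W.b₂ * (u₁.1 * u₂.1) * (u₁.2 * u₂.2) +
    W.b₄ * (u₁.1 * u₂.2 + u₂.1 * u₁.2) * (u₁.2 * u₂.2) + W.b₆ * (u₁.2 * u₂.2) ^ 2
  snd_mul_snd : u₃.2 * u₄.2 = (u₁.1 * u₂.2 + u₂.1 * u₁.2) ^ 2 -
    4 * (u₁.1 * u₂.1) * (u₁.2 * u₂.2)

lemma AddSubRel.map {R S : Type} [CommRing R] [CommRing S] {W : WeierstrassCurve R}
    {u₁ u₂ u₃ u₄ : R × R} (h : AddSubRel W u₁ u₂ u₃ u₄) (f : R →+* S) :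
    AddSubRel (W.map f) (Prod.map f f u₁) (Prod.map f f u₂) (Prod.map f f u₃)
      (Prod.map f f u₄) := by
  constructor
  · simpa using congrArg f h.1
  · simpa [map_ofNat f 2] using congrArg f h.2
  · simpa [map_ofNat f 4] using congrArg f h.3

/-- Brings the relation from K(B) down to a local ring of B, from where it can be specialized. -/
lemma AddSubRel.of_map {R S : Type} [CommRing R] [CommRing S] {W : WeierstrassCurve R}
    {u₁ u₂ u₃ u₄ : R × R} {f : R →+* S} (hf : Function.Injective f)
    (h : AddSubRel (W.map f) (Prod.map f f u₁) (Prod.map f f u₂) (Prod.map f f u₃)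
      (Prod.map f f u₄)) : AddSubRel W u₁ u₂ u₃ u₄ := by
  constructor <;> apply hf
  · simpa using h.1
  · simpa [map_ofNat f 2] using h.2
  · simpa [map_ofNat f 4] using h.3

lemma dupX_map {R S : Type} [CommRing R] [CommRing S] (W : WeierstrassCurve R) (f : R →+* S)
    (u : R × R) : dupX (W.map f) (Prod.map f f u) = Prod.map f f (dupX W u) := by
  ext <;> simp [dupX, map_ofNat f 2, map_ofNat f 4]

/-! ## Tate's limit -/

section TateLimit

variable {L : Type} [Field L]

/-- The maximum of the absolute values of the two coordinates. -/
def pairNorm (abv : AbsoluteValue L ℝ) (u : L × L) : ℝ := max (abv u.1) (abv u.2)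

lemma pairNorm_nonneg (abv : AbsoluteValue L ℝ) (u : L × L) : 0 ≤ pairNorm abv u :=
  le_max_of_le_left (abv.nonneg _)

lemma pairNorm_pos (abv : AbsoluteValue L ℝ) {u : L × L} (hu : u ≠ 0) : 0 < pairNorm abv u := by
  rw [pairNorm, lt_max_iff, abv.pos_iff, abv.pos_iff]
  by_contra! h
  exact hu (Prod.ext h.1 h.2)

lemma pairNorm_smul (abv : AbsoluteValue L ℝ) (c : L) (u : L × L) :
    pairNorm abv (c • u) = abv c * pairNorm abv u := by
  simp [pairNorm, mul_max_of_nonneg _ _ (abv.nonneg c)]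

lemma abv_monomial_le (abv : AbsoluteValue L ℝ) (c : L) (u : L × L) (i j : ℕ) :
    abv (c * u.1 ^ i * u.2 ^ j) ≤ abv c * pairNorm abv u ^ (i + j) := by
  have h1 : abv u.1 ≤ pairNorm abv u := le_max_left _ _
  have h2 : abv u.2 ≤ pairNorm abv u := le_max_right _ _
  have h0 := pairNorm_nonneg abv u
  rw [map_mul, map_mul, map_pow, map_pow, pow_add, mul_assoc]
  gcongr

lemma abv_quartic_le (abv : AbsoluteValue L ℝ) (c₀ c₁ c₂ c₃ c₄ : L) (u : L × L) :
    abv (c₀ * u.1 ^ 4 + c₁ * u.1 ^ 3 * u.2 + c₂ * u.1 ^ 2 * u.2 ^ 2 + c₃ * u.1 * u.2 ^ 3 +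
      c₄ * u.2 ^ 4) ≤
      (abv c₀ + abv c₁ + abv c₂ + abv c₃ + abv c₄) * pairNorm abv u ^ 4 := by
  have e₀ := abv_monomial_le abv c₀ u 4 0
  have e₁ := abv_monomial_le abv c₁ u 3 1
  have e₂ := abv_monomial_le abv c₂ u 2 2
  have e₃ := abv_monomial_le abv c₃ u 1 3
  have e₄ := abv_monomial_le abv c₄ u 0 4
  simp only [pow_zero, mul_one, pow_one, Nat.reduceAdd] at e₀ e₁ e₂ e₃ e₄
  refine (abv.add_le _ _).trans ?_
  have a₁ := abv.add_le (c₀ * u.1 ^ 4) (c₁ * u.1 ^ 3 * u.2)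
  have a₂ := abv.add_le (c₀ * u.1 ^ 4 + c₁ * u.1 ^ 3 * u.2) (c₂ * u.1 ^ 2 * u.2 ^ 2)
  have a₃ := abv.add_le (c₀ * u.1 ^ 4 + c₁ * u.1 ^ 3 * u.2 + c₂ * u.1 ^ 2 * u.2 ^ 2)
    (c₃ * u.1 * u.2 ^ 3)
  linarith

lemma pairNorm_dupX_le (abv : AbsoluteValue L ℝ) (W : WeierstrassCurve L) :
    ∃ C, 0 < C ∧ ∀ u, pairNorm abv (dupX W u) ≤ C * pairNorm abv u ^ 4 := by
  refine ⟨(abv 1 + abv 0 + abv (-W.b₄) + abv (-2 * W.b₆) + abv (-W.b₈)) +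
    (abv 0 + abv 4 + abv W.b₂ + abv (2 * W.b₄) + abv W.b₆), ?_, fun u => ?_⟩
  · rw [map_one]
    positivity
  have h₁ := abv_quartic_le abv 1 0 (-W.b₄) (-2 * W.b₆) (-W.b₈) u
  have h₂ := abv_quartic_le abv 0 4 W.b₂ (2 * W.b₄) W.b₆ u
  have e₁ : (dupX W u).1 = 1 * u.1 ^ 4 + 0 * u.1 ^ 3 * u.2 + -W.b₄ * u.1 ^ 2 * u.2 ^ 2 +
    -2 * W.b₆ * u.1 * u.2 ^ 3 + -W.b₈ * u.2 ^ 4 := by simp only [dupX]; ring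
  have e₂ : (dupX W u).2 = 0 * u.1 ^ 4 + 4 * u.1 ^ 3 * u.2 + W.b₂ * u.1 ^ 2 * u.2 ^ 2 +
    2 * W.b₄ * u.1 * u.2 ^ 3 + W.b₆ * u.2 ^ 4 := by simp only [dupX]; ring
  rw [← e₁] at h₁
  rw [← e₂] at h₂
  have hM : 0 ≤ pairNorm abv u ^ 4 := pow_nonneg (pairNorm_nonneg abv u) 4
  rw [add_mul]
  refine max_le (h₁.trans (le_add_of_nonneg_right ?_)) (h₂.trans (le_add_of_nonneg_left ?_)) <;>
    positivity

/-- With `dupX_bezout_snd`, this shows that the two duplication forms have no common zero when Δ ≠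
0. The cofactors are quartic forms, which is the degree needed for the lower bound on `dupX`. -/
lemma dupX_bezout_fst (W : WeierstrassCurve L) (u : L × L) :
    (W.Δ * u.1 ^ 4 + 2 * (2 * W.b₂ * W.b₄ * W.b₈ - 2 * W.b₄ ^ 2 * W.b₆ - 10 * W.b₆ * W.b₈) *
        u.1 ^ 3 * u.2 + (-W.b₂ * W.b₆ * W.b₈ + W.b₄ * W.b₆ ^ 2 +
        4 * (3 * W.b₄ ^ 2 * W.b₈ - 3 * W.b₄ * W.b₆ ^ 2)) * u.1 ^ 2 * u.2 ^ 2 +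
        2 * (3 * W.b₄ * W.b₆ * W.b₈ - 3 * W.b₆ ^ 3) * u.1 * u.2 ^ 3 + 0 * u.2 ^ 4) *
        (dupX W u).1 +
      ((-W.b₂ * W.b₄ * W.b₈ + W.b₄ ^ 2 * W.b₆ + 5 * W.b₆ * W.b₈) * u.1 ^ 4 +
        2 * (2 * W.b₂ * W.b₆ * W.b₈ - 2 * W.b₄ * W.b₆ ^ 2 - 10 * W.b₈ ^ 2) * u.1 ^ 3 * u.2 +
        (-W.b₂ * W.b₈ ^ 2 + W.b₄ * W.b₆ * W.b₈ + 4 * (3 * W.b₄ * W.b₆ * W.b₈ - 3 * W.b₆ ^ 3)) *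
        u.1 ^ 2 * u.2 ^ 2 + 2 * (3 * W.b₄ * W.b₈ ^ 2 - 3 * W.b₆ ^ 2 * W.b₈) * u.1 * u.2 ^ 3 +
        0 * u.2 ^ 4) * (dupX W u).2 = W.Δ * u.1 ^ 8 := by
  simp only [dupX, WeierstrassCurve.Δ]
  have := W.b_relation
  grind only

lemma dupX_bezout_snd (W : WeierstrassCurve L) (u : L × L) :
    (0 * u.1 ^ 4 + 0 * u.1 ^ 3 * u.2 + (-48) * u.1 ^ 2 * u.2 ^ 2 + (-8 * W.b₂) * u.1 * u.2 ^ 3 +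
        (W.b₂ ^ 2 - 32 * W.b₄) * u.2 ^ 4) * (dupX W u).1 +
      (0 * u.1 ^ 4 + 12 * u.1 ^ 3 * u.2 + (-W.b₂) * u.1 ^ 2 * u.2 ^ 2 +
        (-10 * W.b₄) * u.1 * u.2 ^ 3 + (W.b₂ * W.b₄ - 27 * W.b₆) * u.2 ^ 4) * (dupX W u).2 =
      W.Δ * u.2 ^ 8 := by
  simp only [dupX, WeierstrassCurve.Δ]
  have := W.b_relation
  grind only

/-- Reflects (P+Q) + (P−Q) = 2P and (P+Q) − (P−Q) = 2Q. The relation involves `u₃` and `u₄` only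
through their symmetric products, so substitution leaves polynomial identities modulo `b_relation`.
-/
lemma AddSubRel.dupX_right {W : WeierstrassCurve L} {u₁ u₂ u₃ u₄ : L × L}
    (h : AddSubRel W u₁ u₂ u₃ u₄) : AddSubRel W u₃ u₄ (dupX W u₁) (dupX W u₂) := by
  have hb := W.b_relation
  constructor
  · rw [h.1, h.2, h.3]
    simp only [dupX]
    grind only
  · rw [h.1, h.2, h.3]
    simp only [dupX]
    grind only
  · rw [h.1, h.2, h.3]
    simp only [dupX]
    grind only

/-- By the Bézout identities |Δ|·M⁸ is at most a constant times M⁴ times the norm of `dupX W u`,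
where M is the norm of `u`; use the identity for the coordinate that attains M. -/
lemma exists_pow_le_pairNorm_dupX (abv : AbsoluteValue L ℝ) (W : WeierstrassCurve L)
    (hΔ : W.Δ ≠ 0) : ∃ c, 0 < c ∧ ∀ u, c * pairNorm abv u ^ 4 ≤ pairNorm abv (dupX W u) := by
  -- Cofactors and constants stay abstract here; unification supplies them at the end.
  have key : ∀ (p q p' q' : L × L → L) (C C' : ℝ), 0 ≤ C → 0 ≤ C' →
      (∀ u, p u * (dupX W u).1 + q u * (dupX W u).2 = W.Δ * u.1 ^ 8) →
      (∀ u, p' u * (dupX W u).1 + q' u * (dupX W u).2 = W.Δ * u.2 ^ 8) →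
      (∀ u, abv (p u) + abv (q u) ≤ C * pairNorm abv u ^ 4) →
      (∀ u, abv (p' u) + abv (q' u) ≤ C' * pairNorm abv u ^ 4) →
      ∃ c, 0 < c ∧ ∀ u, c * pairNorm abv u ^ 4 ≤ pairNorm abv (dupX W u) := by
    intro p q p' q' C C' hC hC' h₁ h₂ b₁ b₂
    have hd : 0 < abv W.Δ := abv.pos hΔ
    -- The `+ 1` keeps the denominator positive.
    refine ⟨abv W.Δ / (C + C' + 1), by positivity, fun u => ?_⟩
    by_cases hu : u = 0
    · subst hu
      simp [pairNorm]
    have hM := pairNorm_pos abv hu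
    have hD := pairNorm_nonneg abv (dupX W u)
    have bd : ∀ (r s t : L) (D : ℝ), 0 ≤ D → D ≤ C + C' + 1 →
        r * (dupX W u).1 + s * (dupX W u).2 = W.Δ * t ^ 8 →
        abv r + abv s ≤ D * pairNorm abv u ^ 4 → abv W.Δ * abv t ^ 8 ≤
          (C + C' + 1) * pairNorm abv u ^ 4 * pairNorm abv (dupX W u) := by
      intro r s t D hD0 hDC h b
      calc abv W.Δ * abv t ^ 8 = abv (r * (dupX W u).1 + s * (dupX W u).2) := by
            rw [h, map_mul, map_pow]
        _ ≤ abv r * abv (dupX W u).1 + abv s * abv (dupX W u).2 := by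
            rw [← map_mul, ← map_mul]
            exact abv.add_le _ _
        _ ≤ abv r * pairNorm abv (dupX W u) + abv s * pairNorm abv (dupX W u) := by
            gcongr
            · exact le_max_left _ _
            · exact le_max_right _ _
        _ = (abv r + abv s) * pairNorm abv (dupX W u) := by ring
        _ ≤ _ := by
            gcongr
            exact b.trans (by gcongr)
    have main : abv W.Δ * pairNorm abv u ^ 8 ≤
        (C + C' + 1) * pairNorm abv u ^ 4 * pairNorm abv (dupX W u) := by
      rcases max_choice (abv u.1) (abv u.2) with h | h
      · rw [show pairNorm abv u ^ 8 = abv u.1 ^ 8 by rw [pairNorm, h]]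
        exact bd _ _ _ C hC (by linarith) (h₁ u) (b₁ u)
      · rw [show pairNorm abv u ^ 8 = abv u.2 ^ 8 by rw [pairNorm, h]]
        exact bd _ _ _ C' hC' (by linarith) (h₂ u) (b₂ u)
    rw [div_mul_eq_mul_div, div_le_iff₀ (by positivity)]
    refine le_of_mul_le_mul_right ?_ (pow_pos hM 4)
    calc _ = abv W.Δ * pairNorm abv u ^ 8 := by ring
      _ ≤ _ := main
      _ = _ := by ring
  refine key _ _ _ _ _ _ ?_ ?_ (dupX_bezout_fst W) (dupX_bezout_snd W)
    (fun u => (add_le_add (abv_quartic_le abv _ _ _ _ _ u)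
      (abv_quartic_le abv _ _ _ _ _ u)).trans_eq (add_mul _ _ _).symm)
    (fun u => (add_le_add (abv_quartic_le abv _ _ _ _ _ u)
      (abv_quartic_le abv _ _ _ _ _ u)).trans_eq (add_mul _ _ _).symm) <;> positivity

lemma dupX_ne_zero {W : WeierstrassCurve L} (hΔ : W.Δ ≠ 0) {u : L × L} (hu : u ≠ 0) :
    dupX W u ≠ 0 := by
  intro h
  have h₁ := dupX_bezout_fst W u
  have h₂ := dupX_bezout_snd W u
  simp only [h, Prod.fst_zero, Prod.snd_zero, mul_zero, add_zero] at h₁ h₂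
  refine hu (Prod.ext ?_ ?_)
  · simpa [hΔ] using h₁.symm
  · simpa [hΔ] using h₂.symm

lemma dupX_iterate_ne_zero {W : WeierstrassCurve L} (hΔ : W.Δ ≠ 0) {u : L × L} (hu : u ≠ 0)
    (n : ℕ) : (dupX W)^[n] u ≠ 0 := by
  induction n with
  | zero => exact hu
  | succ n ih =>
    rw [Function.iterate_succ_apply']
    exact dupX_ne_zero hΔ ih

lemma dupX_smul (W : WeierstrassCurve L) (c : L) (u : L × L) :
    dupX W (c • u) = c ^ 4 • dupX W u := by
  ext <;> simp only [dupX, Prod.smul_fst, Prod.smul_snd, smul_eq_mul] <;> ring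

lemma dupX_iterate_smul (W : WeierstrassCurve L) (c : L) (u : L × L) (n : ℕ) :
    (dupX W)^[n] (c • u) = c ^ 4 ^ n • (dupX W)^[n] u := by
  induction n with
  | zero => simp
  | succ n ih =>
    rw [Function.iterate_succ_apply', Function.iterate_succ_apply', ih, dupX_smul, ← pow_mul,
      pow_succ]

/-- The terms of Tate's limit for the canonical height on `L²`. -/
noncomputable def tateSeq (abv : AbsoluteValue L ℝ) (W : WeierstrassCurve L) (u : L × L) (n : ℕ) : ℝ :=
  Real.log (pairNorm abv ((dupX W)^[n] u)) / 4 ^ n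

/-- Tate's limit: the homogeneous canonical height on `L²`. -/
noncomputable def tateLimit (abv : AbsoluteValue L ℝ) (W : WeierstrassCurve L) (u : L × L) : ℝ :=
  limUnder atTop (tateSeq abv W u)

lemma localHeight_eq (abv : AbsoluteValue L ℝ) (W : WeierstrassCurve L) (ξ : L) :
    localHeight abv W ξ =
      1 / 2 * tateLimit abv W (ξ, 1) - 1 / 12 * Real.log (abv W.Δ) := rfl

/-- Uniformity in `u` drives Tate's argument: the telescoping differences are O(4⁻ⁿ), so the limit
exists and stays within a bounded distance of the logarithm of the norm. -/
lemma exists_abs_log_pairNorm_dupX_sub_le (abv : AbsoluteValue L ℝ) {W : WeierstrassCurve L}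
    (hΔ : W.Δ ≠ 0) : ∃ C, ∀ u ≠ 0,
      |Real.log (pairNorm abv (dupX W u)) - 4 * Real.log (pairNorm abv u)| ≤ C := by
  obtain ⟨C, hC, h₁⟩ := pairNorm_dupX_le abv W
  obtain ⟨c, hc, h₂⟩ := exists_pow_le_pairNorm_dupX abv W hΔ
  refine ⟨max (Real.log C) (-Real.log c), fun u hu => ?_⟩
  have hM := pairNorm_pos abv hu
  have hD := pairNorm_pos abv (dupX_ne_zero hΔ hu)
  have e₁ := Real.log_le_log hD (h₁ u)
  have e₂ := Real.log_le_log (by positivity) (h₂ u)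
  rw [Real.log_mul hC.ne' (by positivity), Real.log_pow] at e₁
  rw [Real.log_mul hc.ne' (by positivity), Real.log_pow] at e₂
  push_cast at e₁ e₂
  rw [abs_le]
  constructor
  · linarith [le_max_right (Real.log C) (-Real.log c)]
  · linarith [le_max_left (Real.log C) (-Real.log c)]

lemma exists_dist_tateSeq_le (abv : AbsoluteValue L ℝ) {W : WeierstrassCurve L}
    (hΔ : W.Δ ≠ 0) : ∃ C, ∀ u ≠ 0, ∀ n,
      dist (tateSeq abv W u n) (tateSeq abv W u (n + 1)) ≤ C * (1 / 4) ^ n := by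
  obtain ⟨C, hC⟩ := exists_abs_log_pairNorm_dupX_sub_le abv hΔ
  refine ⟨C / 4, fun u hu n => ?_⟩
  have h := hC _ (dupX_iterate_ne_zero hΔ hu n)
  rw [dist_comm, Real.dist_eq, tateSeq, tateSeq, Function.iterate_succ_apply']
  rw [show ∀ a b : ℝ, a / 4 ^ (n + 1) - b / 4 ^ n = (a - 4 * b) * ((1 / 4) * (1 / 4) ^ n) by
    intro a b
    rw [one_div_pow]
    field_simp
    ring]
  rw [abs_mul, abs_of_pos (by positivity : (0 : ℝ) < 1 / 4 * (1 / 4) ^ n)]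
  calc _ ≤ C * (1 / 4 * (1 / 4) ^ n) := by gcongr
    _ = _ := by ring

lemma tendsto_tateSeq (abv : AbsoluteValue L ℝ) {W : WeierstrassCurve L} (hΔ : W.Δ ≠ 0)
    {u : L × L} (hu : u ≠ 0) : Tendsto (tateSeq abv W u) atTop (𝓝 (tateLimit abv W u)) := by
  obtain ⟨C, hC⟩ := exists_dist_tateSeq_le abv hΔ
  exact (cauchySeq_of_le_geometric _ _ (by norm_num) (hC u hu)).tendsto_limUnder

lemma exists_abs_tateLimit_sub_le (abv : AbsoluteValue L ℝ) {W : WeierstrassCurve L}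
    (hΔ : W.Δ ≠ 0) : ∃ C, ∀ u ≠ 0,
      |tateLimit abv W u - Real.log (pairNorm abv u)| ≤ C := by
  obtain ⟨C, hC⟩ := exists_dist_tateSeq_le abv hΔ
  refine ⟨C / (1 - 1 / 4), fun u hu => ?_⟩
  have := dist_le_of_le_geometric_of_tendsto₀ _ _ (by norm_num) (hC u hu)
    (tendsto_tateSeq abv hΔ hu)
  rw [dist_comm, Real.dist_eq] at this
  simpa [tateSeq] using this

lemma tateLimit_dupX (abv : AbsoluteValue L ℝ) {W : WeierstrassCurve L} (hΔ : W.Δ ≠ 0)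
    {u : L × L} (hu : u ≠ 0) : tateLimit abv W (dupX W u) = 4 * tateLimit abv W u := by
  have h₁ := tendsto_tateSeq abv hΔ (dupX_ne_zero hΔ hu)
  have h₂ := ((tendsto_add_atTop_iff_nat 1).mpr (tendsto_tateSeq abv hΔ hu)).const_mul 4
  refine tendsto_nhds_unique h₁ (h₂.congr fun n => ?_)
  rw [tateSeq, tateSeq, Function.iterate_succ_apply]
  field_simp
  ring

lemma tateLimit_smul (abv : AbsoluteValue L ℝ) {W : WeierstrassCurve L} (hΔ : W.Δ ≠ 0)
    {c : L} (hc : c ≠ 0) {u : L × L} (hu : u ≠ 0) :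
    tateLimit abv W (c • u) = Real.log (abv c) + tateLimit abv W u := by
  have h₁ := tendsto_tateSeq abv hΔ (smul_ne_zero hc hu)
  have h₂ := (tendsto_tateSeq abv hΔ hu).const_add (Real.log (abv c))
  refine tendsto_nhds_unique h₁ (h₂.congr fun n => ?_)
  rw [tateSeq, tateSeq, dupX_iterate_smul, pairNorm_smul, map_pow,
    Real.log_mul (pow_ne_zero _ (abv.ne_zero hc))
      (pairNorm_pos abv (dupX_iterate_ne_zero hΔ hu n)).ne', Real.log_pow]
  push_cast
  field_simp

/-- The pair represents O and is fixed by duplication, so T = 4T. -/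
lemma tateLimit_one_zero (abv : AbsoluteValue L ℝ) {W : WeierstrassCurve L} (hΔ : W.Δ ≠ 0) :
    tateLimit abv W (1, 0) = 0 := by
  have h0 : ((1, 0) : L × L) ≠ 0 := by simp
  have h := tateLimit_dupX abv hΔ h0
  rw [show dupX W (1, 0) = (1, 0) by simp [dupX]] at h
  linarith

/-- A Gauss-type inequality: the three quantities are the coefficients of the product of two linear
forms. The factor 2 allows for absolute values that are not ultrametric. -/
lemma pairNorm_mul_pairNorm_le (abv : AbsoluteValue L ℝ) {u w : L × L} {M : ℝ}
    (h₁ : abv (u.1 * w.1) ≤ M) (h₂ : abv (u.1 * w.2 + w.1 * u.2) ≤ M)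
    (h₃ : abv (u.2 * w.2) ≤ M) : pairNorm abv u * pairNorm abv w ≤ 2 * M := by
  have hM : 0 ≤ M := (abv.nonneg _).trans h₁
  -- If |a| > 2M, then |b| ≥ |a| − |a+b| > M, which contradicts |ab| ≤ M².
  have cross : ∀ a b : L, abv (a * b) ≤ M * M → abv (a + b) ≤ M → abv a ≤ 2 * M := by
    intro a b hab hs
    by_contra! ha
    have hb : abv a ≤ abv (a + b) + abv b := by
      simpa using abv.sub_le_add (a + b) b
    have : 2 * M * M ≤ abv a * abv b := by
      have : M ≤ abv b := by linarith
      exact mul_le_mul ha.le this hM (abv.nonneg a)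
    rw [map_mul] at hab
    have : 0 < abv a * abv b := by
      apply mul_pos <;> linarith
    nlinarith
  have hc : abv ((u.1 * w.2) * (w.1 * u.2)) ≤ M * M := by
    rw [show (u.1 * w.2) * (w.1 * u.2) = (u.1 * w.1) * (u.2 * w.2) by ring, map_mul]
    exact mul_le_mul h₁ h₃ (abv.nonneg _) hM
  have c₁ := cross _ _ hc h₂
  have c₂ := cross _ _ (by rwa [mul_comm]) (by rwa [add_comm] at h₂)
  rw [map_mul] at c₁ c₂ h₁ h₃
  unfold pairNorm
  rcases max_choice (abv u.1) (abv u.2) with h | h <;>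
    rcases max_choice (abv w.1) (abv w.2) with h' | h' <;> rw [h, h'] <;> linarith

lemma exists_addSubRel_pairNorm_le (abv : AbsoluteValue L ℝ) (W : WeierstrassCurve L) :
    ∃ C, 0 < C ∧ ∀ u₁ u₂ u₃ u₄, AddSubRel W u₁ u₂ u₃ u₄ →
      pairNorm abv u₃ * pairNorm abv u₄ ≤ C * (pairNorm abv u₁ * pairNorm abv u₂) ^ 2 := by
  -- The relation consists of quadratic forms in `s`, `t`, `z`, each of absolute value at most 2N. A
  -- monomial thus contributes at most 4N² times the size of its coefficient.
  set D := 4 * (abv 1 + abv 2 + abv (-4) + abv W.b₂ + abv W.b₄ + abv (-W.b₄) + abv W.b₆ +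
    abv (-W.b₆) + abv (-W.b₈)) with hD
  refine ⟨2 * D, ?_, fun u₁ u₂ u₃ u₄ h => ?_⟩
  · rw [hD, map_one]
    positivity
  set N := pairNorm abv u₁ * pairNorm abv u₂ with hN
  have hN0 : 0 ≤ N := mul_nonneg (pairNorm_nonneg _ _) (pairNorm_nonneg _ _)
  have l₁ : abv u₁.1 ≤ pairNorm abv u₁ := le_max_left _ _
  have r₁ : abv u₁.2 ≤ pairNorm abv u₁ := le_max_right _ _
  have l₂ : abv u₂.1 ≤ pairNorm abv u₂ := le_max_left _ _
  have r₂ : abv u₂.2 ≤ pairNorm abv u₂ := le_max_right _ _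
  have n₁ := pairNorm_nonneg abv u₁
  have prod : ∀ a b : L, abv a ≤ pairNorm abv u₁ → abv b ≤ pairNorm abv u₂ → abv (a * b) ≤ N := by
    intro a b ha hb
    rw [map_mul]
    exact mul_le_mul ha hb (abv.nonneg _) n₁
  obtain ⟨s, hs⟩ : ∃ s, u₁.1 * u₂.1 = s := ⟨_, rfl⟩
  obtain ⟨t, ht⟩ : ∃ t, u₁.1 * u₂.2 + u₂.1 * u₁.2 = t := ⟨_, rfl⟩
  obtain ⟨z, hz⟩ : ∃ z, u₁.2 * u₂.2 = z := ⟨_, rfl⟩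
  have bs : abv s ≤ 2 * N := by
    have := prod _ _ l₁ l₂
    rw [hs] at this
    linarith
  have bz : abv z ≤ 2 * N := by
    have := prod _ _ r₁ r₂
    rw [hz] at this
    linarith
  have bt : abv t ≤ 2 * N := by
    have a₁ := prod _ _ l₁ r₂
    have a₂ := prod _ _ r₁ l₂
    have := abv.add_le (u₁.1 * u₂.2) (u₂.1 * u₁.2)
    rw [ht] at this
    rw [mul_comm u₂.1] at this
    linarith
  have mono : ∀ c a b : L, abv a ≤ 2 * N → abv b ≤ 2 * N →
      abv (c * a * b) ≤ abv c * 4 * N ^ 2 := by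
    intro c a b ha hb
    rw [map_mul, map_mul]
    calc abv c * abv a * abv b ≤ abv c * (2 * N) * (2 * N) := by gcongr
      _ = _ := by ring
  have nn := fun c : L => mul_nonneg (mul_nonneg (abv.nonneg c) zero_le_four) (sq_nonneg N)
  have add3 : ∀ a b c d : L, abv (a + b + c + d) ≤ abv a + abv b + abv c + abv d := by
    intro a b c d
    have := abv.add_le (a + b + c) d
    have := abv.add_le (a + b) c
    have := abv.add_le a b
    linarith
  have n1 := nn 1
  have n2 := nn 2
  have n4 := nn (-4)
  have nb2 := nn W.b₂
  have nb4 := nn W.b₄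
  have nb4' := nn (-W.b₄)
  have nb6 := nn W.b₆
  have nb6' := nn (-W.b₆)
  have nb8 := nn (-W.b₈)
  have hDN : D * N ^ 2 = abv 1 * 4 * N ^ 2 + abv 2 * 4 * N ^ 2 + abv (-4) * 4 * N ^ 2 +
      abv W.b₂ * 4 * N ^ 2 + abv W.b₄ * 4 * N ^ 2 + abv (-W.b₄) * 4 * N ^ 2 +
      abv W.b₆ * 4 * N ^ 2 + abv (-W.b₆) * 4 * N ^ 2 + abv (-W.b₈) * 4 * N ^ 2 := by
    rw [hD]
    ring
  rw [mul_assoc]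
  refine pairNorm_mul_pairNorm_le abv ?_ ?_ ?_
  · rw [h.1, hs, ht, hz, show s ^ 2 - W.b₄ * s * z - W.b₆ * t * z - W.b₈ * z ^ 2 =
      1 * s * s + -W.b₄ * s * z + -W.b₆ * t * z + -W.b₈ * z * z by ring]
    have := add3 (1 * s * s) (-W.b₄ * s * z) (-W.b₆ * t * z) (-W.b₈ * z * z)
    have := mono 1 s s bs bs
    have := mono (-W.b₄) s z bs bz
    have := mono (-W.b₆) t z bt bz
    have := mono (-W.b₈) z z bz bz
    linarith
  · rw [h.2, hs, ht, hz, show 2 * t * s + W.b₂ * s * z + W.b₄ * t * z + W.b₆ * z ^ 2 =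
      2 * t * s + W.b₂ * s * z + W.b₄ * t * z + W.b₆ * z * z by ring]
    have := add3 (2 * t * s) (W.b₂ * s * z) (W.b₄ * t * z) (W.b₆ * z * z)
    have := mono 2 t s bt bs
    have := mono W.b₂ s z bs bz
    have := mono W.b₄ t z bt bz
    have := mono W.b₆ z z bz bz
    linarith
  · rw [h.3, hs, ht, hz, show t ^ 2 - 4 * s * z = 1 * t * t + -4 * s * z by ring]
    have := abv.add_le (1 * t * t) (-4 * s * z)
    have := mono 1 t t bt bt
    have := mono (-4) s z bs bz
    linarith

/-- The parallelogram law for the canonical height on `L²`. -/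
lemma tateLimit_parallelogram (abv : AbsoluteValue L ℝ) {W : WeierstrassCurve L} (hΔ : W.Δ ≠ 0)
    {u₁ u₂ u₃ u₄ : L × L} (h : AddSubRel W u₁ u₂ u₃ u₄) (h₁ : u₁ ≠ 0) (h₂ : u₂ ≠ 0)
    (h₃ : u₃ ≠ 0) (h₄ : u₄ ≠ 0) :
    tateLimit abv W u₃ + tateLimit abv W u₄ =
      2 * tateLimit abv W u₁ + 2 * tateLimit abv W u₂ := by
  obtain ⟨C₁, hC₁⟩ := exists_abs_tateLimit_sub_le abv hΔ
  obtain ⟨C₂, hC₂, hr⟩ := exists_addSubRel_pairNorm_le abv W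
  set T := tateLimit abv W
  have bound : ∀ {u₁ u₂ u₃ u₄ : L × L}, AddSubRel W u₁ u₂ u₃ u₄ → u₁ ≠ 0 → u₂ ≠ 0 → u₃ ≠ 0 →
      u₄ ≠ 0 → T u₃ + T u₄ - 2 * T u₁ - 2 * T u₂ ≤ Real.log C₂ + 6 * C₁ := by
    intro u₁ u₂ u₃ u₄ h h₁ h₂ h₃ h₄
    have p₁ := pairNorm_pos abv h₁
    have p₂ := pairNorm_pos abv h₂
    have p₃ := pairNorm_pos abv h₃
    have p₄ := pairNorm_pos abv h₄
    have e := Real.log_le_log (by positivity) (hr _ _ _ _ h)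
    rw [Real.log_mul p₃.ne' p₄.ne', Real.log_mul hC₂.ne' (by positivity), Real.log_pow,
      Real.log_mul p₁.ne' p₂.ne'] at e
    push_cast at e
    have b₁ := abs_le.mp (hC₁ _ h₁)
    have b₂ := abs_le.mp (hC₁ _ h₂)
    have b₃ := abs_le.mp (hC₁ _ h₃)
    have b₄ := abs_le.mp (hC₁ _ h₄)
    linarith [b₁.1, b₂.1, b₃.2, b₄.2]
  -- `AddSubRel.dupX_right` turns the defect τ into 4T(u₁) + 4T(u₂) − 2T(u₃) − 2T(u₄) = −2τ, and the
  -- upper bound holds for every related quadruple.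
  have iter : ∀ n : ℕ, ∀ {u₁ u₂ u₃ u₄ : L × L}, AddSubRel W u₁ u₂ u₃ u₄ → u₁ ≠ 0 → u₂ ≠ 0 →
      u₃ ≠ 0 → u₄ ≠ 0 →
      (-2) ^ n * (T u₃ + T u₄ - 2 * T u₁ - 2 * T u₂) ≤ Real.log C₂ + 6 * C₁ := by
    intro n
    induction n with
    | zero => intro u₁ u₂ u₃ u₄ h h₁ h₂ h₃ h₄; simpa using bound h h₁ h₂ h₃ h₄
    | succ n ih =>
      intro u₁ u₂ u₃ u₄ h h₁ h₂ h₃ h₄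
      have := ih h.dupX_right h₃ h₄ (dupX_ne_zero hΔ h₁) (dupX_ne_zero hΔ h₂)
      have e₁ : T (dupX W u₁) = 4 * T u₁ := tateLimit_dupX abv hΔ h₁
      have e₂ : T (dupX W u₂) = 4 * T u₂ := tateLimit_dupX abv hΔ h₂
      rw [e₁, e₂] at this
      refine le_trans (le_of_eq ?_) this
      ring
  set τ := T u₃ + T u₄ - 2 * T u₁ - 2 * T u₂ with hτ
  set D := Real.log C₂ + 6 * C₁
  suffices τ = 0 by linarith
  -- An even number of steps treats τ ≥ 0 and an odd number τ < 0, so (−2)ᵏτ is nonnegative and the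
  -- upper bound controls |τ|.
  have up : ∀ n : ℕ, |τ| * 2 ^ n ≤ max D 0 := by
    intro n
    have hp : (0 : ℝ) < 2 ^ n := by positivity
    rcases le_or_gt 0 τ with hs | hs
    · have := iter (2 * n) h h₁ h₂ h₃ h₄
      rw [pow_mul, show ((-2 : ℝ) ^ 2) = 2 * 2 by norm_num, mul_pow] at this
      have one : (1 : ℝ) ≤ 2 ^ n := one_le_pow₀ one_le_two
      rw [abs_of_nonneg hs]
      refine le_max_of_le_left (le_trans ?_ this)
      rw [mul_comm, mul_assoc]
      exact le_mul_of_one_le_left (by positivity) one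
    · have := iter (2 * n + 1) h h₁ h₂ h₃ h₄
      rw [pow_succ, pow_mul, show ((-2 : ℝ) ^ 2) = 2 * 2 by norm_num, mul_pow] at this
      have one : (1 : ℝ) ≤ 2 ^ n := one_le_pow₀ one_le_two
      rw [abs_of_neg hs]
      refine le_max_of_le_left (le_trans ?_ this)
      have : -τ * 2 ^ n ≤ -τ * 2 ^ n * 2 ^ n := le_mul_of_one_le_right (by nlinarith) one
      nlinarith
  by_contra hne
  have hpos : 0 < |τ| := abs_pos.mpr hne
  obtain ⟨n, hn⟩ := pow_unbounded_of_one_lt (max D 0 / |τ|) one_lt_two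
  rw [div_lt_iff₀ hpos] at hn
  linarith [up n]

end TateLimit

/-! ### Functional equations of the local Néron height -/

section LocalHeight

variable {L : Type} [Field L]

/-- The quasi-parallelogram law for the local Néron height. -/
lemma localHeight_quasiParallelogram (abv : AbsoluteValue L ℝ) {W : WeierstrassCurve L}
    (hΔ : W.Δ ≠ 0) {x₁ x₂ x₃ x₄ : L} (hx : x₁ - x₂ ≠ 0)
    (h : AddSubRel W (x₁, 1) (x₂, 1) ((x₁ - x₂) ^ 2 • (x₃, 1)) (x₄, 1)) :
    localHeight abv W x₃ + localHeight abv W x₄ =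
      2 * localHeight abv W x₁ + 2 * localHeight abv W x₂ -
        Real.log (abv (x₁ - x₂)) + 1 / 6 * Real.log (abv W.Δ) := by
  have n : ∀ x : L, ((x, 1) : L × L) ≠ 0 := fun x => by simp
  have hx2 : (x₁ - x₂) ^ 2 ≠ 0 := pow_ne_zero 2 hx
  -- The scaling by (x₁−x₂)² contributes 2 log|x₁−x₂|, halved in λ̂. The discriminant terms leave
  -- 4/12 − 2/12 = 1/6.
  have := tateLimit_parallelogram abv hΔ h (n _) (n _) (smul_ne_zero hx2 (n _)) (n _)
  rw [tateLimit_smul abv hΔ hx2 (n _), map_pow, Real.log_pow] at this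
  simp only [localHeight_eq]
  push_cast at this
  linarith

/-- The duplication formula for the local Néron height. -/
lemma localHeight_duplication (abv : AbsoluteValue L ℝ) {W : WeierstrassCurve L}
    (hΔ : W.Δ ≠ 0) {x x' : L} (hx : (dupX W (x, 1)).2 ≠ 0)
    (h : (dupX W (x, 1)).2 * x' = (dupX W (x, 1)).1) :
    localHeight abv W x' = 4 * localHeight abv W x -
      1 / 2 * Real.log (abv (dupX W (x, 1)).2) + 1 / 4 * Real.log (abv W.Δ) := by
  have n : ∀ x : L, ((x, 1) : L × L) ≠ 0 := fun x => by simp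
  have e : dupX W (x, 1) = (dupX W (x, 1)).2 • (x', 1) := by
    ext <;> simp [h]
  have := tateLimit_dupX abv hΔ (n x)
  rw [e, tateLimit_smul abv hΔ hx (n _)] at this
  simp only [localHeight_eq]
  linarith

/-- The local Néron height at a point of order two. -/
lemma localHeight_of_dupX_snd_eq_zero (abv : AbsoluteValue L ℝ) {W : WeierstrassCurve L}
    (hΔ : W.Δ ≠ 0) {x : L} (hx : (dupX W (x, 1)).2 = 0) :
    localHeight abv W x = 1 / 8 * Real.log (abv (dupX W (x, 1)).1) -
      1 / 12 * Real.log (abv W.Δ) := by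
  have n : ((x, 1) : L × L) ≠ 0 := by simp
  have hne : (dupX W (x, 1)).1 ≠ 0 := fun h => dupX_ne_zero hΔ n (Prod.ext h hx)
  have e : dupX W (x, 1) = (dupX W (x, 1)).1 • (1, 0) := by
    ext <;> simp [hx]
  have := tateLimit_dupX abv hΔ n
  rw [e, tateLimit_smul abv hΔ hne (by simp), tateLimit_one_zero abv hΔ] at this
  simp only [localHeight_eq]
  linarith

end LocalHeight

/-! ### Sums, differences and doubles in terms of x-coordinates -/

section GroupLaw

variable {L : Type} [Field L] {W : WeierstrassCurve.Affine L}

open WeierstrassCurve.Affine WeierstrassCurve.Affine.Point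

lemma exists_add_sub_eq_some [DecidableEq L] {x₁ y₁ x₂ y₂ : L} (h₁ : W.Nonsingular x₁ y₁)
    (h₂ : W.Nonsingular x₂ y₂) (hx : x₁ ≠ x₂) :
    ∃ x₃ y₃ h₃ x₄ y₄ h₄, Point.some x₁ y₁ h₁ + Point.some x₂ y₂ h₂ = Point.some x₃ y₃ h₃ ∧
      Point.some x₁ y₁ h₁ - Point.some x₂ y₂ h₂ = Point.some x₄ y₄ h₄ ∧
      AddSubRel W (x₁, 1) (x₂, 1) ((x₁ - x₂) ^ 2 • (x₃, 1)) (x₄, 1) := by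
  refine ⟨_, _, _, _, _, _, add_of_X_ne hx, by rw [sub_eq_add_neg, neg_some]; exact add_of_X_ne hx,
    ?_⟩
  have e₁ := (equation_iff ..).mp h₁.1
  have e₂ := (equation_iff ..).mp h₂.1
  have hd : x₁ - x₂ ≠ 0 := sub_ne_zero.mpr hx
  rw [slope_of_X_ne hx, slope_of_X_ne hx]
  constructor
  · simp only [addX, negY, Prod.smul_mk, smul_eq_mul, WeierstrassCurve.b₄, WeierstrassCurve.b₆,
      WeierstrassCurve.b₈]
    field_simp
    grind only
  · simp only [addX, negY, Prod.smul_mk, smul_eq_mul, WeierstrassCurve.b₂, WeierstrassCurve.b₄,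
      WeierstrassCurve.b₆]
    field_simp
    grind only
  · simp only [Prod.smul_mk, smul_eq_mul]
    ring

lemma dupX_snd_eq {x y : L} (h : W.Equation x y) :
    (dupX W (x, 1)).2 = (2 * y + W.a₁ * x + W.a₃) ^ 2 := by
  have e := (equation_iff ..).mp h
  simp only [dupX, WeierstrassCurve.b₂, WeierstrassCurve.b₄, WeierstrassCurve.b₆]
  linear_combination -4 * e

/-- The denominator of the duplication formula is (y − y(−P))², which vanishes exactly when P = −P.
-/
lemma add_self_eq_zero_or_some [DecidableEq L] {x y : L} (h : W.Nonsingular x y) :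
    (Point.some x y h + Point.some x y h = 0 ∧ (dupX W (x, 1)).2 = 0) ∨
    ∃ x' y' h', Point.some x y h + Point.some x y h = Point.some x' y' h' ∧
      (dupX W (x, 1)).2 ≠ 0 ∧ (dupX W (x, 1)).2 * x' = (dupX W (x, 1)).1 := by
  by_cases hy : y = W.negY x y
  · refine .inl ⟨add_self_of_Y_eq hy, ?_⟩
    rw [dupX_snd_eq h.1]
    rw [negY] at hy
    exact pow_eq_zero_iff two_ne_zero |>.mpr (by linear_combination hy)
  · refine .inr ⟨_, _, _, add_self_of_Y_ne hy, ?_, ?_⟩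
    · rw [dupX_snd_eq h.1]
      refine pow_ne_zero 2 fun h0 => hy ?_
      rw [negY]
      linear_combination h0
    · have e := (equation_iff ..).mp h.1
      have hd : y - W.negY x y ≠ 0 := sub_ne_zero.mpr hy
      rw [dupX_snd_eq h.1, slope_of_Y_ne rfl hy]
      have hs : 2 * y + W.a₁ * x + W.a₃ = y - W.negY x y := by rw [negY]; ring
      rw [hs]
      simp only [addX, dupX, WeierstrassCurve.b₄, WeierstrassCurve.b₆, WeierstrassCurve.b₈]
      field_simp
      rw [← hs]
      grind only

end GroupLaw

/-! ### Maps satisfying the parallelogram law -/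

section Quadratic

variable {A V : Type*} [AddCommGroup A] [AddCommGroup V] [Module ℝ V] {q : A → V}

/-- The Jordan–von Neumann argument: four instances of the law combine to additivity of the polar
form. -/
lemma parallelogram_polar_add_left
    (hq : ∀ P Q, q (P + Q) + q (P - Q) = (2 : ℝ) • q P + (2 : ℝ) • q Q) (P R Q : A) : q (P + R + Q) - q (P + R) - q Q =
    (q (P + Q) - q P - q Q) + (q (R + Q) - q R - q Q) := by
  have h₁ := hq (P + Q) R
  have h₂ := hq P (R - Q)
  have h₃ := hq R Q
  have h₅ := hq (P + R) Q
  rw [show P + Q + R = P + R + Q by abel, show P + Q - R = P - (R - Q) by abel] at h₁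
  rw [show P + (R - Q) = P + R - Q by abel] at h₂
  linear_combination (norm := module) (1 / 2 : ℝ) • h₁ - (1 / 2 : ℝ) • h₂ + (1 / 2 : ℝ) • h₅ - h₃

lemma exists_polar_of_parallelogram
    (hq : ∀ P Q, q (P + Q) + q (P - Q) = (2 : ℝ) • q P + (2 : ℝ) • q Q) :
    ∃ b : A →+ A →+ V, (∀ P Q, b P Q = b Q P) ∧ (∀ P, b P P = (2 : ℝ) • q P) ∧
      ∀ P Q, q (P + Q) = q P + q Q + b P Q := by
  have h0 : q 0 = 0 := by
    have := hq 0 0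
    rw [add_zero, sub_zero] at this
    linear_combination (norm := module) (-1 / 2 : ℝ) • this
  have hadd := parallelogram_polar_add_left hq
  refine ⟨AddMonoidHom.mk' (fun P => AddMonoidHom.mk' (fun Q => q (P + Q) - q P - q Q)
    fun Q R => ?_) fun P R => ?_, fun P Q => ?_, fun P => ?_, fun P Q => ?_⟩
  · have := hadd Q R P
    rw [add_comm P, add_comm P, add_comm P]
    linear_combination (norm := module) this
  · ext Q
    exact hadd P R Q
  · simp only [AddMonoidHom.mk'_apply, add_comm P Q]
    abel
  · have := hq P P
    rw [sub_self, h0] at this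
    simp only [AddMonoidHom.mk'_apply]
    linear_combination (norm := module) this
  · simp only [AddMonoidHom.mk'_apply]
    abel

/-- A torsion element T pairs to zero with everything, because V is torsion-free; then q(T) =
b(T,T)/2 = 0 as well. -/
lemma parallelogram_eq_of_isOfFinAddOrder
    (hq : ∀ P Q, q (P + Q) + q (P - Q) = (2 : ℝ) • q P + (2 : ℝ) • q Q) {P Q : A} (h : IsOfFinAddOrder (P - Q)) :
    q P = q Q := by
  obtain ⟨b, -, hd, hb⟩ := exists_polar_of_parallelogram hq
  obtain ⟨n, hn, hnT⟩ := isOfFinAddOrder_iff_nsmul_eq_zero.mp h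
  have hz : ∀ R, b (P - Q) R = 0 := by
    intro R
    have : n • b (P - Q) R = 0 := by
      rw [← AddMonoidHom.nsmul_apply, ← map_nsmul, hnT, map_zero, AddMonoidHom.zero_apply]
    rw [← Nat.cast_smul_eq_nsmul ℝ] at this
    exact (smul_eq_zero.mp this).resolve_left (by exact_mod_cast hn.ne')
  have hT : q (P - Q) = 0 := by
    have := hd (P - Q)
    rw [hz] at this
    exact (smul_eq_zero.mp this.symm).resolve_left two_ne_zero
  have := hb (P - Q) Q
  rwa [sub_add_cancel, hT, hz, zero_add, add_zero] at this

lemma parallelogram_sum_zsmul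
    (hq : ∀ P Q, q (P + Q) + q (P - Q) = (2 : ℝ) • q P + (2 : ℝ) • q Q) (m : ℕ) (P : Fin m → A) (a : Fin m → ℤ) :
    q (∑ i, a i • P i) =
      (∑ i, ((a i : ℝ) ^ 2 - (a i : ℝ) * ∑ j ∈ Finset.univ.erase i, (a j : ℝ)) • q (P i)) +
        ∑ i, ∑ j ∈ Finset.Ioi i, ((a i : ℝ) * (a j : ℝ)) • q (P i + P j) := by
  obtain ⟨b, hs, hd, hb⟩ := exists_polar_of_parallelogram hq
  -- Groups the ordered pairs i ≠ j into unordered pairs. It is applied to the polar terms and to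
  -- the asymmetric terms in `q (P i)` that arise from b(Pᵢ,Pⱼ) = q(Pᵢ+Pⱼ) − q(Pᵢ) − q(Pⱼ).
  have hsplit : ∀ f : Fin m → Fin m → V, ∑ i, ∑ j ∈ Finset.univ.erase i, f i j =
      ∑ i, ∑ j ∈ Finset.Ioi i, (f i j + f j i) := by
    intro f
    have hu : ∀ i : Fin m, Finset.univ.erase i = Finset.Ioi i ∪ Finset.Iio i := by
      intro i
      ext j
      simp only [Finset.mem_erase, Finset.mem_univ, and_true, Finset.mem_union, Finset.mem_Ioi,
        Finset.mem_Iio]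
      rw [or_comm]
      exact ne_iff_lt_or_gt
    have hdj : ∀ i : Fin m, Disjoint (Finset.Ioi i) (Finset.Iio i) := by
      intro i
      rw [Finset.disjoint_left]
      intro j h₁ h₂
      exact lt_asymm (Finset.mem_Ioi.mp h₁) (Finset.mem_Iio.mp h₂)
    simp_rw [hu, fun i => Finset.sum_union (hdj i) (f := f i), Finset.sum_add_distrib]
    congr 1
    exact Finset.sum_comm' (by simp)
  have hz : ∀ (n : ℤ) (R : A →+ V) (x : A), R (n • x) = (n : ℝ) • R x := by
    intro n R x
    rw [map_zsmul, Int.cast_smul_eq_zsmul]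
  have hz' : ∀ (n : ℤ) (x y : A), b (n • x) y = (n : ℝ) • b x y := by
    intro n x y
    rw [hs, hz, hs]
  have lhs : (2 : ℝ) • q (∑ i, a i • P i) =
      ∑ i, ((a i : ℝ) ^ 2 * 2) • q (P i) +
        ∑ i, ∑ j ∈ Finset.univ.erase i, ((a i : ℝ) * a j) • b (P i) (P j) := by
    rw [← hd, map_sum, ← Finset.sum_add_distrib]
    refine Finset.sum_congr rfl fun i _ => ?_
    rw [hs, map_sum, ← Finset.add_sum_erase _ _ (Finset.mem_univ i)]
    simp only [hz, hz', smul_smul]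
    rw [hd, smul_smul, sq]
    refine congrArg _ (Finset.sum_congr rfl fun j _ => ?_)
    rw [mul_comm]
  have e₁ := hsplit fun i j => ((a i : ℝ) * a j) • b (P i) (P j)
  have e₂ := hsplit fun i j => ((a i : ℝ) * a j) • q (P i)
  have rhs : ∀ i, ((a i : ℝ) ^ 2 - (a i : ℝ) * ∑ j ∈ Finset.univ.erase i, (a j : ℝ)) • q (P i) =
      (1 / 2 : ℝ) • ((a i : ℝ) ^ 2 * 2) • q (P i) -
        ∑ j ∈ Finset.univ.erase i, ((a i : ℝ) * a j) • q (P i) := by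
    intro i
    rw [sub_smul, Finset.mul_sum, Finset.sum_smul, smul_smul]
    congr 2
    ring
  have key : q (∑ i, a i • P i) = (1 / 2 : ℝ) • (2 : ℝ) • q (∑ i, a i • P i) := by
    module
  rw [key, lhs, Finset.sum_congr rfl fun i _ => rhs i, Finset.sum_sub_distrib, ← Finset.smul_sum,
    e₁, e₂, smul_add, sub_add_eq_add_sub, add_sub_assoc, ← Finset.sum_sub_distrib]
  congr 1
  rw [Finset.smul_sum]
  refine Finset.sum_congr rfl fun i _ => ?_
  rw [← Finset.sum_sub_distrib, Finset.smul_sum]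
  refine Finset.sum_congr rfl fun j _ => ?_
  rw [hb, hs (P j)]
  module

end Quadratic

/-! ### Local rings of étale algebras -/

section LocalRing

open IsLocalRing

/-- The local rings of an étale algebra over a principal ideal domain have a principal maximal
ideal. -/
lemma maximalIdeal_isPrincipal_of_etale {R S : Type} [CommRing R]
    [IsPrincipalIdealRing R] [CommRing S] [Algebra R S] [Algebra.Etale R S]
    (q : Ideal S) [q.IsPrime] (T : Type) [CommRing T] [Algebra S T] [IsLocalization.AtPrime T q]
    [IsLocalRing T] : (maximalIdeal T).IsPrincipal := by
  let p := q.under R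
  let := Localization.AtPrime.algebraOfLiesOver p q
  have : Algebra.IsUnramifiedAt R q := inferInstance
  -- Unramifiedness: the prime below generates the maximal ideal upstairs, so a generator of that
  -- prime does too.
  have h := ((Algebra.isUnramifiedAt_iff_map_eq R p q).mp this).2
  obtain ⟨a, ha⟩ := (IsPrincipalIdealRing.principal p).principal
  let e := (IsLocalization.algEquiv q.primeCompl (Localization.AtPrime q) T).toRingEquiv
  have hp : maximalIdeal (Localization.AtPrime q) =
      Ideal.span {algebraMap R (Localization.AtPrime q) a} := by
    rw [← h, ha, Ideal.submodule_span_eq, Ideal.map_span, Set.image_singleton]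
  have he : maximalIdeal T = (maximalIdeal (Localization.AtPrime q)).map e :=
    (eq_maximalIdeal (Ideal.map_isMaximal_of_equiv e)).symm
  rw [he, hp, Ideal.map_span, Set.image_singleton]
  exact ⟨⟨_, rfl⟩⟩

end LocalRing

/-! ### Local rings of the curve and orders of vanishing -/

namespace SmoothProjCurve

variable {K : Type} [Field K] (B : SmoothProjCurve K)

/-- Smoothness of relative dimension one makes the curve locally étale over the affine line, and
polynomials in one variable over a field form a principal ideal domain. -/
lemma maximalIdeal_stalk_isPrincipal (x : B.X) :
    (IsLocalRing.maximalIdeal (B.X.presheaf.stalk x)).IsPrincipal := by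
  obtain ⟨U, hU, V, hV, hx, e, hf⟩ :=
    B.smooth.exists_isStandardSmoothOfRelativeDimension x
  obtain ⟨g, -, hg⟩ := hf.exists_etale_mvPolynomial
  have hUtop : U = ⊤ := by
    have : Subsingleton (Spec (.of K)) := inferInstanceAs (Subsingleton (PrimeSpectrum K))
    ext y
    simp only [TopologicalSpace.Opens.coe_top, Set.mem_univ, iff_true]
    rw [Subsingleton.elim y (B.str x)]
    exact e hx
  subst hUtop
  have hfield : IsField Γ(Spec (.of K), ⊤) :=
    (Scheme.ΓSpecIso (.of K)).commRingCatIsoToRingEquiv.isField (Field.toIsField K)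
  let := hfield.toField
  have : IsPrincipalIdealRing (MvPolynomial (Fin 1) Γ(Spec (.of K), ⊤)) :=
    IsPrincipalIdealRing.of_surjective
      (MvPolynomial.uniqueAlgEquiv Γ(Spec (.of K), ⊤) (Fin 1)).symm
      (MvPolynomial.uniqueAlgEquiv Γ(Spec (.of K), ⊤) (Fin 1)).symm.surjective
  algebraize [g]
  let := TopCat.Presheaf.algebra_section_stalk B.X.presheaf (⟨x, hx⟩ : V)
  have : IsLocalization.AtPrime (B.X.presheaf.stalk x) (hV.primeIdealOf ⟨x, hx⟩).asIdeal :=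
    hV.isLocalization_stalk ⟨x, hx⟩
  exact maximalIdeal_isPrincipal_of_etale (R := MvPolynomial (Fin 1) Γ(Spec (.of K), ⊤))
    (hV.primeIdealOf ⟨x, hx⟩).asIdeal (B.X.presheaf.stalk x)

lemma isDiscreteValuationRing_stalk {x : B.X} (hx : ¬ IsField (B.X.presheaf.stalk x)) :
    IsDiscreteValuationRing (B.X.presheaf.stalk x) :=
  ((IsDiscreteValuationRing.TFAE _ hx).out 4 0).mp (B.maximalIdeal_stalk_isPrincipal x)

lemma isDiscreteValuationRing_stalk_of_coheight {x : B.X} (hx : Order.coheight x = 1) :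
    IsDiscreteValuationRing (B.X.presheaf.stalk x) := by
  refine B.isDiscreteValuationRing_stalk fun h => ?_
  have := ringKrullDim_stalk_eq_coheight x
  rw [hx, ringKrullDim_eq_zero_of_isField h] at this
  exact absurd this (by norm_num)

lemma coheight_eq_one_of_not_isField {x : B.X} (hx : ¬ IsField (B.X.presheaf.stalk x)) :
    Order.coheight x = 1 := by
  have := B.isDiscreteValuationRing_stalk hx
  have h := ringKrullDim_stalk_eq_coheight x
  rw [IsDiscreteValuationRing.ringKrullDim_eq_one] at h
  exact_mod_cast h.symm

/-- The absolute value `|φ|_γ = exp (-ord_γ φ)` as an absolute value. -/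
noncomputable def ordAbv (z : B.ClosedPt) : AbsoluteValue B.FF ℝ where
  toFun := B.absOrd z
  map_mul' f g := by
    by_cases hf : f = 0
    · simp [absOrd, hf]
    by_cases hg : g = 0
    · simp [absOrd, hg]
    rw [absOrd, absOrd, absOrd, if_neg hf, if_neg hg, if_neg (mul_ne_zero hf hg),
      Scheme.ord_mul hf hg, ← Real.exp_add]
    push_cast
    ring_nf
  nonneg' f := by
    rw [absOrd]
    split_ifs
    · exact le_rfl
    · exact (Real.exp_pos _).le
  eq_zero' f := by
    rw [absOrd]
    split_ifs with h
    · simp [h]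
    · simp [h, (Real.exp_pos _).ne']
  add_le' f g := by
    by_cases hf : f = 0
    · rw [show f + g = g by rw [hf]; exact zero_add g]
      simp [absOrd, hf]
    by_cases hg : g = 0
    · rw [show f + g = f by rw [hg]; exact add_zero f]
      simp [absOrd, hg]
    by_cases hfg : f + g = 0
    · rw [absOrd, absOrd, absOrd, if_neg hf, if_neg hg, if_pos hfg]
      positivity
    -- The discrete valuation property gives ord(f+g) ≥ min(ord f, ord g).
    have := B.isDiscreteValuationRing_stalk_of_coheight z.2
    have h := Scheme.ord_add (x := z.1) hfg
    rw [absOrd, absOrd, absOrd, if_neg hf, if_neg hg, if_neg hfg]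
    rcases min_le_iff.mp h with h | h
    · refine le_add_of_le_of_nonneg (Real.exp_le_exp.mpr ?_) (Real.exp_pos _).le
      exact neg_le_neg (by exact_mod_cast h)
    · refine le_add_of_nonneg_of_le (Real.exp_pos _).le (Real.exp_le_exp.mpr ?_)
      exact neg_le_neg (by exact_mod_cast h)

@[simp]
lemma coe_ordAbv (z : B.ClosedPt) : ⇑(B.ordAbv z) = B.absOrd z := rfl

lemma log_absOrd (z : B.ClosedPt) {φ : B.FF} (hφ : φ ≠ 0) :
    Real.log (B.absOrd z φ) = -(B.X.ord φ z.1 : ℝ) := by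
  rw [absOrd, if_neg hφ, Real.log_exp]

variable {B} {v : NumberFieldPlace K}

/-- A nonzero rational function without zero or pole at the centre of `x` is a unit there. -/
lemma exists_isUnit_of_offSupport {x : B.Ban v} {φ : B.FF} (hφ : φ ≠ 0)
    (h : OffSupport (principal φ).1 x) :
    ∃ s : B.X.presheaf.stalk (center x), IsUnit s ∧ algebraMap _ B.FF s = φ := by
  -- If the stalk is a field, every nonzero function is a unit and the support condition is not
  -- needed. Otherwise the stalk is a discrete valuation ring, where order zero means unit.
  by_cases hf : IsField (B.X.presheaf.stalk (center x))
  · let := hf.toField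
    obtain ⟨a, b, hb, hab⟩ := IsFractionRing.div_surjective (A := B.X.presheaf.stalk (center x)) φ
    have hb0 : b ≠ 0 := nonZeroDivisors.ne_zero hb
    have ha0 : a ≠ 0 := by
      rintro rfl
      simp at hab
      exact hφ hab.symm
    obtain ⟨c, hc⟩ := hf.mul_inv_cancel hb0
    refine ⟨a * c, ?_, ?_⟩
    · have hc0 : c ≠ 0 := by
        rintro rfl
        simp at hc
      obtain ⟨d, hd⟩ := hf.mul_inv_cancel (mul_ne_zero ha0 hc0)
      exact IsUnit.of_mul_eq_one _ hd
    · have hbF : algebraMap _ B.FF b ≠ 0 := by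
        simpa using hb0
      rw [← hab, map_mul, eq_div_iff hbF, mul_assoc, ← map_mul, mul_comm c, hc, map_one, mul_one]
  · have hz := B.coheight_eq_one_of_not_isField hf
    have := B.isDiscreteValuationRing_stalk hf
    have ho : B.X.ord φ (center x) = 0 := by
      have := h ⟨center x, hz⟩ rfl
      simpa [principal] using this
    rw [Scheme.ord_eq_iff hz hφ] at ho
    have h1 : Ring.ordFrac (B.X.presheaf.stalk (center x)) φ = 1 := by
      simpa [Scheme.ordHom] using ho
    obtain ⟨u, hu⟩ := Ring.associated_of_ordFrac_eq (R := B.X.presheaf.stalk (center x)) 1 φ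
      (by rw [h1, map_one])
    exact ⟨u, u.isUnit, by rw [← hu, Units.smul_def, Algebra.smul_def, mul_one]⟩

/-! ## Specialization -/

/-- The value at `x` of the rational functions that are regular at the centre of `x`. -/
noncomputable def specialize (x : B.Ban v) : B.X.presheaf.stalk (center x) →+* Kappa x :=
  ((pullback.fst B.str (Spec.map (CommRingCat.ofHom v.emb))).residueFieldMap x.pt).hom.comp
    (B.X.residue (center x)).hom

lemma regular_algebraMap (x : B.Ban v) (s : B.X.presheaf.stalk (center x)) :
    Regular x (algebraMap _ B.FF s) := ⟨s, rfl⟩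

lemma value_algebraMap (x : B.Ban v) (s : B.X.presheaf.stalk (center x)) :
    value x (algebraMap _ B.FF s) = specialize x s := by
  have h := regular_algebraMap x s
  rw [value, dif_pos h]
  have hc : h.choose = s :=
    IsFractionRing.injective (B.X.presheaf.stalk (center x)) B.FF h.choose_spec
  rw [hc]
  rfl

/-- The support condition is imposed only on nonzero functions, so that vanishing coefficients and
coordinates are allowed. -/
lemma exists_algebraMap_eq {x : B.Ban v} {φ : B.FF}
    (h : φ ≠ 0 → OffSupport (principal φ).1 x) :
    ∃ s : B.X.presheaf.stalk (center x), algebraMap _ B.FF s = φ := by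
  by_cases hφ : φ = 0
  · exact ⟨0, by rw [map_zero, hφ]⟩
  · obtain ⟨s, -, hs⟩ := exists_isUnit_of_offSupport hφ (h hφ)
    exact ⟨s, hs⟩

lemma value_ne_zero {x : B.Ban v} {φ : B.FF} (hφ : φ ≠ 0)
    (h : OffSupport (principal φ).1 x) : value x φ ≠ 0 := by
  obtain ⟨s, hs, rfl⟩ := exists_isUnit_of_offSupport hφ h
  rw [value_algebraMap]
  exact (hs.map (specialize x)).ne_zero

/-- The coefficients of a Weierstrass equation. -/
def coeffs (E : WeierstrassCurve B.FF) : Set B.FF := {E.a₁, E.a₂, E.a₃, E.a₄, E.a₆}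

/-- Gives an equation over the local ring lying between E and its fibre, through which polynomial
identities pass from K(B) to the residue field. -/
lemma exists_model {E : WeierstrassCurve B.FF} {x : B.Ban v}
    (h : ∀ c ∈ coeffs E, c ≠ 0 → OffSupport (principal c).1 x) :
    ∃ W : WeierstrassCurve (B.X.presheaf.stalk (center x)),
      W.map (algebraMap _ B.FF) = E ∧ fibre E x = W.map (specialize x) := by
  obtain ⟨c₁, h₁⟩ := exists_algebraMap_eq (h E.a₁ (by simp [coeffs]))
  obtain ⟨c₂, h₂⟩ := exists_algebraMap_eq (h E.a₂ (by simp [coeffs]))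
  obtain ⟨c₃, h₃⟩ := exists_algebraMap_eq (h E.a₃ (by simp [coeffs]))
  obtain ⟨c₄, h₄⟩ := exists_algebraMap_eq (h E.a₄ (by simp [coeffs]))
  obtain ⟨c₆, h₆⟩ := exists_algebraMap_eq (h E.a₆ (by simp [coeffs]))
  refine ⟨⟨c₁, c₂, c₃, c₄, c₆⟩, ?_, ?_⟩
  · ext <;> simpa [WeierstrassCurve.map]
  · simp only [fibre, ← h₁, ← h₂, ← h₃, ← h₄, ← h₆, value_algebraMap, WeierstrassCurve.map]

lemma fibre_Δ {E : WeierstrassCurve B.FF} {x : B.Ban v}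
    (h : ∀ c ∈ coeffs E, c ≠ 0 → OffSupport (principal c).1 x) :
    (fibre E x).Δ = value x E.Δ := by
  obtain ⟨W, hW, hf⟩ := exists_model h
  rw [hf, ← hW, WeierstrassCurve.map_Δ, WeierstrassCurve.map_Δ, value_algebraMap]

/-- Outside the discarded supports only the explicit height occurs; the extension by continuity
plays no role in the comparison. -/
lemma green_eq {E : WeierstrassCurve B.FF} {ξ : B.FF} {x : B.Ban v}
    (h : ∀ c ∈ coeffs E, c ≠ 0 → OffSupport (principal c).1 x) (hΔ : E.Δ ≠ 0)
    (hΔx : OffSupport (principal E.Δ).1 x) (hξ : ξ ≠ 0 → OffSupport (principal ξ).1 x) :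
    green E ξ x = localHeight x.abv (fibre E x) (value x ξ) := by
  have hreg : ∀ c ∈ coeffs E, Regular x c := fun c hc => exists_algebraMap_eq (h c hc)
  have hgood : GoodAt E ξ x :=
    ⟨hreg _ (by simp [coeffs]), hreg _ (by simp [coeffs]), hreg _ (by simp [coeffs]),
      hreg _ (by simp [coeffs]), hreg _ (by simp [coeffs]),
      by rw [fibre_Δ h]; exact value_ne_zero hΔ hΔx, exists_algebraMap_eq hξ⟩
  rw [green, if_pos hgood, fibreHeight]

lemma value_zero (x : B.Ban v) : value x 0 = 0 := by
  rw [← map_zero (algebraMap (B.X.presheaf.stalk (center x)) B.FF), value_algebraMap, map_zero]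

lemma exists_value_dupX {E : WeierstrassCurve B.FF} {ξ : B.FF} {x : B.Ban v}
    (h : ∀ c ∈ coeffs E, c ≠ 0 → OffSupport (principal c).1 x)
    (hξ : ξ ≠ 0 → OffSupport (principal ξ).1 x) :
    ∃ s₁ s₂ : B.X.presheaf.stalk (center x), (dupX E (ξ, 1)).1 = algebraMap _ B.FF s₁ ∧
      (dupX E (ξ, 1)).2 = algebraMap _ B.FF s₂ ∧
      (dupX (fibre E x) (value x ξ, 1)).1 = specialize x s₁ ∧
      (dupX (fibre E x) (value x ξ, 1)).2 = specialize x s₂ := by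
  obtain ⟨W, hW, hf⟩ := exists_model h
  obtain ⟨s, rfl⟩ := exists_algebraMap_eq hξ
  have e₁ := dupX_map W (algebraMap _ B.FF) (s, 1)
  have e₂ := dupX_map W (specialize x) (s, 1)
  rw [hW, Prod.map_apply, map_one] at e₁
  rw [← hf, Prod.map_apply, map_one, ← value_algebraMap] at e₂
  exact ⟨_, _, congrArg Prod.fst e₁, congrArg Prod.snd e₁, congrArg Prod.fst e₂,
    congrArg Prod.snd e₂⟩

/-! ## The space of principal metrized divisors -/

/-- The real linear combinations of principal metrized divisors, the functions being compared
outside the support of finitely many principal divisors. -/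
def principalSpan (B : SmoothProjCurve K) : Submodule ℝ (MetrizedDivisor B) where
  carrier := {M | ∃ (ι : Type) (_ : Fintype ι) (φ : ι → B.FF) (a : ι → ℝ), (∀ i, φ i ≠ 0) ∧
    M.1 = ∑ i, a i • (principal (φ i)).1 ∧
    ∀ (v : NumberFieldPlace K) (x : B.Ban v), (∀ i, OffSupport (principal (φ i)).1 x) →
      M.2 v x = ∑ i, a i * (principal (φ i)).2 v x}
  zero_mem' := ⟨Empty, inferInstance, Empty.elim, Empty.elim, fun i => i.elim, by simp, by simp⟩
  add_mem' := by
    rintro M N ⟨ι, _, φ, a, hφ, h₁, h₂⟩ ⟨κ, _, ψ, b, hψ, k₁, k₂⟩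
    -- Uniting the families enlarges the excluded supports, so both comparisons remain available.
    refine ⟨ι ⊕ κ, inferInstance, Sum.elim φ ψ, Sum.elim a b, ?_, ?_, ?_⟩
    · rintro (i | i)
      · exact hφ i
      · exact hψ i
    · rw [Prod.fst_add, h₁, k₁, Fintype.sum_sum_type]
      rfl
    · intro v x hx
      rw [Prod.snd_add, Pi.add_apply, Pi.add_apply, h₂ v x fun i => hx (.inl i),
        k₂ v x fun i => hx (.inr i), Fintype.sum_sum_type]
      rfl
  smul_mem' := by
    rintro c M ⟨ι, _, φ, a, hφ, h₁, h₂⟩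
    refine ⟨ι, inferInstance, φ, c • a, hφ, ?_, fun v x hx => ?_⟩
    · rw [Prod.smul_fst, h₁, Finset.smul_sum]
      simp [smul_smul]
    · rw [Prod.smul_snd, Pi.smul_apply, Pi.smul_apply, h₂ v x hx, smul_eq_mul, Finset.mul_sum]
      simp [mul_assoc]

lemma isomorphic_of_sub_mem_principalSpan {M N : MetrizedDivisor B}
    (h : M - N ∈ principalSpan B) : Isomorphic M N := by
  obtain ⟨ι, _, φ, a, hφ, h₁, h₂⟩ := h
  let e := Fintype.equivFin ι
  refine ⟨Fintype.card ι, φ ∘ e.symm, a ∘ e.symm, fun i => hφ _, ?_, fun v x _ _ hx => ?_⟩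
  · rw [← Prod.fst_sub, h₁]
    exact (e.symm.sum_comp fun i => a i • (principal (φ i)).1).symm
  · rw [← Pi.sub_apply, ← Pi.sub_apply, ← Prod.snd_sub,
      h₂ v x fun i => by simpa using hx (e i)]
    exact (e.symm.sum_comp fun i => a i * (principal (φ i)).2 v x).symm

/-- To compare metrized divisors, one may discard the zeros and poles of finitely many nonzero
rational functions: the comparison then takes place outside finitely many points of `B(K̄)`, which
determines functions that are continuous outside the supports. The discarded functions enter the
linear combination with coefficient zero. -/
lemma mem_principalSpan {M : MetrizedDivisor B} {ι : Type} [Fintype ι] (φ : ι → B.FF) (a : ι → ℝ)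
    (hφ : ∀ i, φ i ≠ 0) {T : Set B.FF} (hT : T.Finite)
    (h₁ : ∀ z, M.1 z = -∑ i, a i * Real.log (B.absOrd z (φ i)))
    (h₂ : ∀ (v : NumberFieldPlace K) (x : B.Ban v),
      (∀ c ∈ T, c ≠ 0 → OffSupport (principal c).1 x) →
      (∀ i, OffSupport (principal (φ i)).1 x) →
      M.2 v x = -∑ i, a i * Real.log (x.abv (value x (φ i)))) : M ∈ principalSpan B := by
  have : Fintype {c // c ∈ T ∧ c ≠ 0} := (hT.subset fun c hc => hc.1).fintype
  refine ⟨ι ⊕ {c // c ∈ T ∧ c ≠ 0}, inferInstance, Sum.elim φ Subtype.val, Sum.elim a 0, ?_, ?_, ?_⟩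
  · rintro (i | c)
    · exact hφ i
    · exact c.2.2
  · ext z
    rw [h₁, Fintype.sum_sum_type]
    simp [principal, log_absOrd, hφ]
  · intro v x hx
    rw [h₂ v x (fun c hc hc0 => hx (.inr ⟨c, hc, hc0⟩)) fun i => hx (.inl i), Fintype.sum_sum_type]
    simp [principal]

/-! ## The parallelogram law for `D̄` -/

lemma coeffs_finite (E : WeierstrassCurve B.FF) : (coeffs E).Finite := by
  rw [coeffs]
  exact Set.toFinite _

lemma Dbar_neg (E : WeierstrassCurve B.FF) (P : MW E) : Dbar E (-P) = Dbar E P := by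
  cases P <;> rfl

variable (E : WeierstrassCurve B.FF) [E.IsElliptic]

lemma Dbar_quasiParallelogram {x₁ y₁ x₂ y₂ : B.FF} (h₁ : E.toAffine.Nonsingular x₁ y₁)
    (h₂ : E.toAffine.Nonsingular x₂ y₂) (hx : x₁ ≠ x₂) (P Q : MW E)
    (hP : P = WeierstrassCurve.Affine.Point.some x₁ y₁ h₁)
    (hQ : Q = WeierstrassCurve.Affine.Point.some x₂ y₂ h₂) :
    Dbar E (P + Q) + Dbar E (P - Q) - ((2 : ℝ) • Dbar E P + (2 : ℝ) • Dbar E Q) ∈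
      principalSpan B := by
  classical
  obtain ⟨x₃, y₃, h₃, x₄, y₄, h₄, e₃, e₄, hrel⟩ := exists_add_sub_eq_some h₁ h₂ hx
  have e₃' : P + Q = WeierstrassCurve.Affine.Point.some x₃ y₃ h₃ := by
    rw [← e₃, hP, hQ]
  have e₄' : P - Q = WeierstrassCurve.Affine.Point.some x₄ y₄ h₄ := by
    rw [← e₄, hP, hQ]
  rw [e₃', e₄', hP, hQ]
  have hΔ : E.Δ ≠ 0 := E.isUnit_Δ.ne_zero
  have hd : x₁ - x₂ ≠ 0 := sub_ne_zero.mpr hx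
  -- The coefficients are those of −log|x₁−x₂| and −log|Δ| in the quasi-parallelogram law. The set
  -- `T` makes the equation and all four x-coordinates regular at the centre.
  refine mem_principalSpan (ι := Fin 2) ![x₁ - x₂, E.Δ] ![1, -1 / 6] ?_
    (T := coeffs E ∪ {x₁, x₂, x₃, x₄}) ((coeffs_finite E).union (Set.toFinite _)) ?_ ?_
  · intro i
    fin_cases i
    · exact hd
    · exact hΔ
  · intro z
    have := localHeight_quasiParallelogram (B.ordAbv z) hΔ hd hrel
    simp only [coe_ordAbv] at this
    simp [Dbar, Fin.sum_univ_two]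
    linarith
  · intro v x hT hφ
    have hdx : OffSupport (principal (x₁ - x₂)).1 x := hφ 0
    have hΔx : OffSupport (principal E.Δ).1 x := hφ 1
    have hc : ∀ c ∈ coeffs E, c ≠ 0 → OffSupport (principal c).1 x := fun c hc => hT c (.inl hc)
    have t₁ := hT x₁ (.inr (by simp))
    have t₂ := hT x₂ (.inr (by simp))
    have t₃ := hT x₃ (.inr (by simp))
    have t₄ := hT x₄ (.inr (by simp))
    have hfΔ : (fibre E x).Δ ≠ 0 := by
      rw [fibre_Δ hc]
      exact value_ne_zero hΔ hΔx
    have hdv := value_ne_zero hd hdx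
    obtain ⟨W, hW, hWx⟩ := exists_model hc
    obtain ⟨s₁, g₁⟩ := exists_algebraMap_eq t₁
    obtain ⟨s₂, g₂⟩ := exists_algebraMap_eq t₂
    obtain ⟨s₃, g₃⟩ := exists_algebraMap_eq t₃
    obtain ⟨s₄, g₄⟩ := exists_algebraMap_eq t₄
    -- The relation descends to the local ring by injectivity, then specializes to the fibre.
    have hrel' : AddSubRel W (s₁, 1) (s₂, 1) ((s₁ - s₂) ^ 2 • (s₃, 1)) (s₄, 1) := by
      refine AddSubRel.of_map (f := algebraMap _ B.FF) (IsFractionRing.injective _ _) ?_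
      rw [hW]
      simpa [g₁, g₂, g₃, g₄] using hrel
    have hsub : value x (x₁ - x₂) = value x x₁ - value x x₂ := by
      rw [← g₁, ← g₂, ← map_sub, value_algebraMap, value_algebraMap, value_algebraMap, map_sub]
    have hrel'' : AddSubRel (fibre E x) (value x x₁, 1) (value x x₂, 1)
        ((value x x₁ - value x x₂) ^ 2 • (value x x₃, 1)) (value x x₄, 1) := by
      rw [hWx, ← g₁, ← g₂, ← g₃, ← g₄]
      simpa [value_algebraMap] using hrel'.map (specialize x)
    rw [hsub] at hdv
    have := localHeight_quasiParallelogram x.abv hfΔ hdv hrel''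
    rw [← hsub, fibre_Δ hc] at this
    simp [Dbar, Fin.sum_univ_two, green_eq hc hΔ hΔx t₁, green_eq hc hΔ hΔx t₂,
      green_eq hc hΔ hΔx t₃, green_eq hc hΔ hΔx t₄]
    linarith

/-- This is the parallelogram law for P = Q, where the chord formula fails and the difference is O.
-/
lemma Dbar_add_self (P : MW E) :
    Dbar E (P + P) - (4 : ℝ) • Dbar E P ∈ principalSpan B := by
  classical
  obtain _ | ⟨x₁, y₁, h₁⟩ := P
  · have h0 : (WeierstrassCurve.Affine.Point.zero : MW E) = 0 := rfl
    rw [h0, add_zero, show Dbar E 0 = 0 from rfl, smul_zero, sub_zero]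
    exact zero_mem _
  have hΔ : E.Δ ≠ 0 := E.isUnit_Δ.ne_zero
  rcases add_self_eq_zero_or_some h₁ with ⟨e, hG⟩ | ⟨x', y', h', e, hG, hF⟩
  · have e' : (WeierstrassCurve.Affine.Point.some x₁ y₁ h₁ : MW E) +
        WeierstrassCurve.Affine.Point.some x₁ y₁ h₁ = 0 := by
      rw [← e]
    have hF : (dupX E (x₁, 1)).1 ≠ 0 := fun h => dupX_ne_zero hΔ (by simp) (Prod.ext h hG)
    rw [e', show Dbar E 0 = 0 from rfl]
    -- Here 2P = O contributes zero, and the coefficients are 4 · 1/8 and −4 · 1/12.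
    refine mem_principalSpan (ι := Fin 2) ![(dupX E (x₁, 1)).1, E.Δ] ![1 / 2, -1 / 3] ?_
      (T := coeffs E ∪ {x₁}) ((coeffs_finite E).union (Set.toFinite _)) ?_ ?_
    · intro i
      fin_cases i
      · exact hF
      · exact hΔ
    · intro z
      have := localHeight_of_dupX_snd_eq_zero (B.ordAbv z) hΔ hG
      simp only [coe_ordAbv] at this
      simp [Dbar, Fin.sum_univ_two]
      linarith
    · intro v x hT hφ
      have hΔx : OffSupport (principal E.Δ).1 x := hφ 1
      have hc : ∀ c ∈ coeffs E, c ≠ 0 → OffSupport (principal c).1 x := fun c hc => hT c (.inl hc)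
      have t₁ := hT x₁ (.inr (by simp))
      have hfΔ : (fibre E x).Δ ≠ 0 := by
        rw [fibre_Δ hc]
        exact value_ne_zero hΔ hΔx
      obtain ⟨s₁, s₂, k₁, k₂, k₃, k₄⟩ := exists_value_dupX hc t₁
      rw [k₂] at hG
      have := localHeight_of_dupX_snd_eq_zero x.abv hfΔ (x := value x x₁) (by
        rw [k₄, ← value_algebraMap, hG, value_zero])
      rw [k₃, ← value_algebraMap, ← k₁, fibre_Δ hc] at this
      simp [Dbar, Fin.sum_univ_two, green_eq hc hΔ hΔx t₁]
      linarith
  · have e' : (WeierstrassCurve.Affine.Point.some x₁ y₁ h₁ : MW E) +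
        WeierstrassCurve.Affine.Point.some x₁ y₁ h₁ =
          WeierstrassCurve.Affine.Point.some x' y' h' := by
      rw [← e]
    rw [e']
    refine mem_principalSpan (ι := Fin 2) ![(dupX E (x₁, 1)).2, E.Δ] ![1 / 2, -1 / 4] ?_
      (T := coeffs E ∪ {x₁, x'}) ((coeffs_finite E).union (Set.toFinite _)) ?_ ?_
    · intro i
      fin_cases i
      · exact hG
      · exact hΔ
    · intro z
      have := localHeight_duplication (B.ordAbv z) hΔ hG hF
      simp only [coe_ordAbv] at this
      simp [Dbar, Fin.sum_univ_two]
      linarith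
    · intro v x hT hφ
      have hGx : OffSupport (principal (dupX E (x₁, 1)).2).1 x := hφ 0
      have hΔx : OffSupport (principal E.Δ).1 x := hφ 1
      have hc : ∀ c ∈ coeffs E, c ≠ 0 → OffSupport (principal c).1 x := fun c hc => hT c (.inl hc)
      have t₁ := hT x₁ (.inr (by simp))
      have t₂ := hT x' (.inr (by simp))
      have hfΔ : (fibre E x).Δ ≠ 0 := by
        rw [fibre_Δ hc]
        exact value_ne_zero hΔ hΔx
      have hGv := value_ne_zero hG hGx
      obtain ⟨s₁, s₂, k₁, k₂, k₃, k₄⟩ := exists_value_dupX hc t₁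
      obtain ⟨s', g'⟩ := exists_algebraMap_eq t₂
      have hF' : s₂ * s' = s₁ := by
        apply IsFractionRing.injective (B.X.presheaf.stalk (center x)) B.FF
        rw [map_mul, ← k₂, g', hF, k₁]
      rw [k₂, value_algebraMap] at hGv
      have := localHeight_duplication x.abv hfΔ (x := value x x₁) (x' := value x x')
        (by rwa [k₄]) (by rw [k₄, k₃, ← g', value_algebraMap, ← map_mul, hF'])
      rw [k₄, ← value_algebraMap, ← k₂, fibre_Δ hc] at this
      simp [Dbar, Fin.sum_univ_two, green_eq hc hΔ hΔx t₁, green_eq hc hΔ hΔx t₂]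
      linarith

/-- Apart from P = O, Q = O and P = ±Q, the x-coordinates differ and the generic law applies. For P
= −Q, evenness of D̄ reduces to duplication. -/
lemma Dbar_parallelogram (P Q : MW E) :
    Dbar E (P + Q) + Dbar E (P - Q) - ((2 : ℝ) • Dbar E P + (2 : ℝ) • Dbar E Q) ∈
      principalSpan B := by
  have hDO : Dbar E 0 = 0 := rfl
  by_cases hP : P = 0
  · rw [hP, zero_add, zero_sub, Dbar_neg, hDO, smul_zero, zero_add, two_smul, sub_self]
    exact zero_mem _
  by_cases hQ : Q = 0
  · rw [hQ, add_zero, sub_zero, hDO, smul_zero, add_zero, two_smul, sub_self]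
    exact zero_mem _
  have hdup : ∀ R : MW E, Dbar E (R + R) + 0 - ((2 : ℝ) • Dbar E R + (2 : ℝ) • Dbar E R) ∈
      principalSpan B := by
    intro R
    rw [add_zero, ← add_smul, show (2 : ℝ) + 2 = 4 by norm_num]
    exact Dbar_add_self E R
  by_cases h₁ : P = Q
  · rw [h₁, sub_self, hDO]
    exact hdup Q
  by_cases h₂ : P = -Q
  · rw [h₂, neg_add_cancel, hDO, Dbar_neg, zero_add, show -Q - Q = -(Q + Q) by abel, Dbar_neg]
    simpa using hdup Q
  obtain _ | ⟨x₁, y₁, k₁⟩ := P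
  · exact absurd rfl hP
  obtain _ | ⟨x₂, y₂, k₂⟩ := Q
  · exact absurd rfl hQ
  refine Dbar_quasiParallelogram E k₁ k₂ (fun hx => ?_) _ _ rfl rfl
  rcases WeierstrassCurve.Affine.Point.X_eq_iff.mp hx with h | h
  · exact h₁ h
  · exact h₂ h

lemma mkQ_Dbar_parallelogram (P Q : MW E) :
    (principalSpan B).mkQ (Dbar E (P + Q)) + (principalSpan B).mkQ (Dbar E (P - Q)) =
      (2 : ℝ) • (principalSpan B).mkQ (Dbar E P) + (2 : ℝ) • (principalSpan B).mkQ (Dbar E Q) := by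
  rw [← map_smul, ← map_smul, ← map_add, ← map_add, ← sub_eq_zero, ← map_sub,
    Submodule.mkQ_apply, Submodule.Quotient.mk_eq_zero]
  exact Dbar_parallelogram E P Q

end SmoothProjCurve

/-! ### Torsion invariance and the quadratic expansion -/

theorem mainTheorem12 {K : Type} [Field K] [NumberField K] (B : SmoothProjCurve K)
    (E : WeierstrassCurve B.FF) [E.IsElliptic] (hE : ¬ SmoothProjCurve.IsIsotrivial E) :
    (∀ P Q : SmoothProjCurve.MW E, IsOfFinAddOrder (P - Q) →
      SmoothProjCurve.Isomorphic (SmoothProjCurve.Dbar E P) (SmoothProjCurve.Dbar E Q)) ∧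
    (∀ (m : ℕ) (P : Fin m → SmoothProjCurve.MW E) (a : Fin m → ℤ), LinearIndependent ℤ P →
      SmoothProjCurve.Isomorphic
        (SmoothProjCurve.Dbar E (∑ i, a i • P i))
        ((∑ i, ((a i : ℝ) ^ 2 - (a i : ℝ) * ∑ j ∈ Finset.univ.erase i, (a j : ℝ)) •
            SmoothProjCurve.Dbar E (P i)) +
          ∑ i, ∑ j ∈ Finset.Ioi i, ((a i : ℝ) * (a j : ℝ)) •
            SmoothProjCurve.Dbar E (P i + P j))) := by
  have hq := SmoothProjCurve.mkQ_Dbar_parallelogram E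
  refine ⟨fun P Q h => ?_, fun m P a _ => ?_⟩ <;>
    refine SmoothProjCurve.isomorphic_of_sub_mem_principalSpan ?_ <;>
    -- In the quotient by the principal span both isomorphisms become equalities for a map that
    -- satisfies the parallelogram law exactly.
    rw [← Submodule.Quotient.mk_eq_zero, ← Submodule.mkQ_apply, map_sub, sub_eq_zero]
  · exact parallelogram_eq_of_isOfFinAddOrder (q := fun P =>
      (SmoothProjCurve.principalSpan B).mkQ (SmoothProjCurve.Dbar E P)) hq h
  · refine (parallelogram_sum_zsmul (q := fun P =>
      (SmoothProjCurve.principalSpan B).mkQ (SmoothProjCurve.Dbar E P)) hq m P a).trans ?_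
    simp only [map_add, map_sum, map_smul]
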